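/- **Setting.** Let $n,d,m,b,T_o\ge 1$. Agent $i\in\{1,\dots,n\}$ holds $m$ data samples $z_{i,1},\dots,z_{i,m}$; put $f_i(x)=\frac1m\sum_{j}\ell(x;z_{i,j})$ and $f=\frac1n\sum_i f_i$ on $\mathbb R^d$, where $\ell(\cdot\,;z_{i,j})$ is differentiable, each $f_i$ has an $L$-Lipschitz gradient ($L>0$), and $f^\star=\inf f>-\infty$. Let $W\in\mathbb R^{n\times n}$ be a mixing matrix of an undirected graph on the agents (nonnegative, doubly stochastic, $w_{ij}=0$ iff $i\ne j$ and $\{i,j\}$ is not an edge), $J=\frac1n\mathbf 1\mathbf 1^\top$, $\lambda_w=1-\|W-J\|_2^2$, $p\in[0,1]$, and assume $\lambda_p=\lambda_w+p(1-\lambda_w)>0$. **Algorithm (PISCO)** with step sizes $\eta_l,\eta_c$. Every evaluation of $G$ below uses, for each agent, a fresh random mini-batch of size $b$ from the agent's data; column $i$ of $G$ is the average over agent $i$'s mini-batch of $\nabla\ell(x_i;z)$, with $x_i$ the $i$-th column of the point $X\in\mathbb R^{d\times n}$ at which $G$ is evaluated. All mini-batches and the choices of the $W^k$ are mutually independent.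 Every local stochastic gradient at a fixed $x$ is unbiased for $\nabla f_i(x)$ with $\mathbb E\|g_i-\nabla f_i(x)\|^2\le\sigma^2/b$, where $\sigma>0$. Start with $X^0=x^0\mathbf 1^\top$, $Y^0=G^0$. In round $k=0,1,\dots$ put $(X^{k+1,0},Y^{k+1,0},G^{k+1,0})=(X^k,Y^k,G^k)$; for $t=1,\dots,T_o$ set $X^{k+1,t}=X^{k+1,t-1}-\eta_lY^{k+1,t-1}$, evaluate $G^{k+1,t}$ at $X^{k+1,t}$, and set $Y^{k+1,t}=Y^{k+1,t-1}+G^{k+1,t}-G^{k+1,t-1}$; then, with $W^k=J$ with probability $p$ and $W^k=W$ otherwise, set $X^{k+1}=\big((1-\eta_c)X^k+\eta_c(X^{k+1,T_o}-\eta_lY^{k+1,T_o})\big)W^k$, evaluate $G^{k+1}$ at $X^{k+1}$, and set $Y^{k+1}=(Y^{k+1,T_o}+G^{k+1}-G^{k+1,T_o})W^k$. Let $\bar x^k$ be the average of the columns of $X^k$, $\tilde f=f(x^0)-f^\star$ and $E_0=\mathbb E\|Y^0-Y^0J\|_F^2$. **Corollary.** There is an absolute constant $C>0$ such that the following holds in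 every such setting and for every $\alpha\ge1$. For each number of rounds $K\ge1$ run PISCO with $\eta_c=\alpha\sqrt{1+p}\,\lambda_p$ and $$\eta_l=\frac1{\alpha T_o}\min\Big\{\Big(\tfrac{nbT_o\tilde f}{(1+p)\lambda_p^2L\sigma^2K}\Big)^{1/2},\Big(\tfrac{\sqrt{1+p}\,\lambda_pb\tilde f}{(1-p)L^2\sigma^2K}\Big)^{1/3},\Big(\tfrac{\alpha^2b\tilde f}{\sqrt{1+p}\,\lambda_pL^2\sigma^2K}\Big)^{1/3}\Big\}$$ (for $p=1$ the second entry is omitted), and call $K$ *sufficiently large* if $$K\ge\max\Big\{\tfrac{360^2nT_obL\tilde f}{(1+p)^2\lambda_p^4\sigma^2},\ \tfrac{360^3bL\tilde f}{(1-p^2)\lambda_p^2\sigma^2}\mathbf 1_{p<1},\ \tfrac{360^3\alpha^2bL\tilde f}{(1+p)^2\lambda_p^4\sigma^2}\Big\}.$$ 1. (Rate) If $K$ is sufficiently large, then $$\frac1K\sum_{k=0}^{K-1}\mathbb E\|\nabla f(\bar x^k)\|^2\le C\Big[\Big(\tfrac{L\tilde f\sigma^2}{nT_obK}\Big)^{1/2}+\Big(\tfrac{L\tilde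 f\sigma}{\alpha\sqrt{1+p}\,\lambda_p\sqrt b\,K}\Big)^{2/3}+\Big(\tfrac{\sqrt{1-p}\,L\tilde f\sigma}{(1+p)\lambda_p^2\sqrt b\,K}\Big)^{2/3}+\tfrac{E_0}{nK}\Big].$$ 2. (Communication complexity) For every $\epsilon>0$, if $K$ is sufficiently large and $$K\ge C\Big[\tfrac{L\tilde f\sigma^2}{nT_ob\,\epsilon^4}+\tfrac{L\tilde f\sigma}{\alpha\sqrt{1+p}\,\lambda_p\sqrt b\,\epsilon^3}+\tfrac{\sqrt{1-p}\,L\tilde f\sigma}{(1+p)\lambda_p^2\sqrt b\,\epsilon^3}+\tfrac{E_0}{n\epsilon^2}\Big],$$ then $\frac1K\sum_{k=0}^{K-1}\mathbb E\|\nabla f(\bar x^k)\|^2\le\epsilon^2$. 3. (Linear speedup) There is $K_0$, depending on the setting and on $\alpha$, such that for all $K\ge K_0$ $$\frac1K\sum_{k=0}^{K-1}\mathbb E\|\nabla f(\bar x^k)\|^2\le C\Big(\tfrac{L\tilde f\sigma^2}{nT_obK}\Big)^{1/2}.$$ -/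

import Mathlib

open MeasureTheory ProbabilityTheory

noncomputable section

namespace PISCO

/-- The space `ℝ^d` with the Euclidean norm. -/
abbrev Vec (d : ℕ) : Type := EuclideanSpace ℝ (Fin d)

/-- A matrix in `ℝ^{d × n}`, given by its `n` columns (one column per agent). -/
abbrev Stack (n d : ℕ) : Type := Fin n → Vec d

/-! ### Network -/

/-- `W` is a mixing matrix of the undirected graph `G`: nonnegative, doubly stochastic, and
`w i j = 0` exactly when `i ≠ j` and `{i, j}` is not an edge. -/
structure IsMixingMatrix {n : ℕ} (G : SimpleGraph (Fin n)) (W : Matrix (Fin n) (Fin n) ℝ) :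
    Prop where
  nonneg : ∀ i j, 0 ≤ W i j
  support : ∀ i j, W i j = 0 ↔ (¬ G.Adj i j ∧ i ≠ j)
  row_sum : ∀ i, ∑ j, W i j = 1
  col_sum : ∀ j, ∑ i, W i j = 1

/-- The averaging matrix `J = (1/n) 1 1ᵀ`. -/
def avgMatrix (n : ℕ) : Matrix (Fin n) (Fin n) ℝ := fun _ _ => 1 / (n : ℝ)

/-- The mixing rate `λ_w = 1 - ‖W - J‖₂²` (spectral norm). -/
def mixingRate {n : ℕ} (W : Matrix (Fin n) (Fin n) ℝ) : ℝ :=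
  1 - ‖Matrix.toEuclideanCLM (n := Fin n) (𝕜 := ℝ) (W - avgMatrix n)‖ ^ 2

/-- The expected mixing rate `λ_p = λ_w + p (1 - λ_w)`. -/
def expectedMixingRate {n : ℕ} (p : ℝ) (W : Matrix (Fin n) (Fin n) ℝ) : ℝ :=
  mixingRate W + p * (1 - mixingRate W)

/-! ### Columns, averages, norms -/

/-- The matrix product `X W`, for `X ∈ ℝ^{d × n}` and `W ∈ ℝ^{n × n}`. -/
def mix {n d : ℕ} (X : Stack n d) (W : Matrix (Fin n) (Fin n) ℝ) : Stack n d :=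
  fun j => ∑ i, W i j • X i

/-- The average of the columns of `X`. -/
def colAvg {n d : ℕ} (X : Stack n d) : Vec d := (1 / (n : ℝ)) • ∑ i, X i

/-- The squared Frobenius norm. -/
def frobSq {n d : ℕ} (X : Stack n d) : ℝ := ∑ i, ‖X i‖ ^ 2

/-! ### Objective and mini-batch gradients -/

/-- The local objective of an agent with data set `D`: the average loss over its `m` samples. -/
def localObj {d m : ℕ} {S : Type*} (loss : Vec d → S → ℝ) (D : Fin m → S) (x : Vec d) : ℝ :=
  (1 / (m : ℝ)) * ∑ j, loss x (D j)

/-- The global objective: the average of the local objectives. -/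
def globalObj {n d m : ℕ} {S : Type*} (loss : Vec d → S → ℝ) (D : Fin n → Fin m → S)
    (x : Vec d) : ℝ :=
  (1 / (n : ℝ)) * ∑ i, localObj loss (D i) x

/-- The local stochastic gradient at `x` over the mini-batch of the `b` samples `D (Z r)`. -/
def batchGrad {d m b : ℕ} {S : Type*} (loss : Vec d → S → ℝ) (D : Fin m → S)
    (Z : Fin b → Fin m) (x : Vec d) : Vec d :=
  (1 / (b : ℝ)) • ∑ r, gradient (fun y => loss y (D (Z r))) x

/-- The distributed stochastic gradient: agent `i` uses its mini-batch `Z i` at its own `X i`. -/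
def stochGrad {n d m b : ℕ} {S : Type*} (loss : Vec d → S → ℝ) (D : Fin n → Fin m → S)
    (Z : Fin n → Fin b → Fin m) (X : Stack n d) : Stack n d :=
  fun i => batchGrad loss (D i) (Z i) (X i)

/-! ### The algorithm -/

/-- The triple `(X, Y, G)` that the algorithm maintains. -/
structure State (n d : ℕ) where
  X : Stack n d
  Y : Stack n d
  G : Stack n d

/-- The state after `t` local updates from the state `s`; the `t`-th local update evaluates the
stochastic gradient `g t`. -/
def localUpdates {n d : ℕ} (ηl : ℝ) (g : ℕ → Stack n d → Stack n d) (s : State n d) :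
    ℕ → State n d
  | 0 => s
  | t + 1 =>
    let s' := localUpdates ηl g s t
    let X' := s'.X - ηl • s'.Y
    let G' := g (t + 1) X'
    { X := X', Y := s'.Y + G' - s'.G, G := G' }

/-- The communication update with matrix `W`, where `s` is the state at the start of the round,
`s'` the state after the local updates, and `g` the stochastic gradient at the new point. -/
def communicate {n d : ℕ} (ηl ηc : ℝ) (W : Matrix (Fin n) (Fin n) ℝ)
    (g : Stack n d → Stack n d) (s s' : State n d) : State n d :=
  let X' := mix ((1 - ηc) • s.X + ηc • (s'.X - ηl • s'.Y)) W
  let G' := g X'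
  { X := X', Y := mix (s'.Y + G' - s'.G) W, G := G' }

/-- The state `(X^k, Y^k, G^k)` after `k` communication rounds. Here `g k 0` is the stochastic
gradient over the mini-batch of the communication update that produces `X^k` (for `k = 0`: over
the initial mini-batch), `g (k + 1) t` with `t ≥ 1` is the one over the mini-batch of the `t`-th
local update in the round from `k` to `k + 1`, and `Wk k` is the communication matrix of that
round. -/
def run {n d : ℕ} (To : ℕ) (ηl ηc : ℝ) (x0 : Vec d) (Wk : ℕ → Matrix (Fin n) (Fin n) ℝ)
    (g : ℕ → ℕ → Stack n d → Stack n d) : ℕ → State n d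
  | 0 =>
    let X0 : Stack n d := fun _ => x0
    { X := X0, Y := g 0 0 X0, G := g 0 0 X0 }
  | k + 1 =>
    let s := run To ηl ηc x0 Wk g k
    communicate ηl ηc (Wk k) (g (k + 1) 0) s (localUpdates ηl (g (k + 1)) s To)

/-- The random communication matrix: `J` if the coin shows `true`, and `W` otherwise. -/
def commMatrix {n : ℕ} (W : Matrix (Fin n) (Fin n) ℝ) (c : Bool) : Matrix (Fin n) (Fin n) ℝ :=
  if c then avgMatrix n else W

/-- PISCO, driven by the mini-batches `Z i k t` of the agents and by the coins `c k`. -/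
def pisco {n d m b : ℕ} {S Ω : Type*} (loss : Vec d → S → ℝ) (D : Fin n → Fin m → S)
    (W : Matrix (Fin n) (Fin n) ℝ) (x0 : Vec d) (To : ℕ) (ηl ηc : ℝ)
    (Z : Fin n → ℕ → ℕ → Ω → Fin b → Fin m) (c : ℕ → Ω → Bool) (ω : Ω) : ℕ → State n d :=
  run To ηl ηc x0 (fun k => commMatrix W (c k ω))
    (fun k t => stochGrad loss D (fun i => Z i k t ω))

/-- `(1/K) ∑_{k < K} E ‖∇f(x̄^k)‖²`, where `x̄^k` is the average model estimate. -/
def avgGradNormSq {n d m b : ℕ} {S Ω : Type*} [MeasurableSpace Ω] (μ : Measure Ω)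
    (loss : Vec d → S → ℝ) (D : Fin n → Fin m → S)
    (W : Matrix (Fin n) (Fin n) ℝ) (x0 : Vec d) (To : ℕ) (ηl ηc : ℝ)
    (Z : Fin n → ℕ → ℕ → Ω → Fin b → Fin m) (c : ℕ → Ω → Bool) (K : ℕ) : ℝ :=
  (1 / (K : ℝ)) * ∑ k ∈ Finset.range K,
    ∫ ω, ‖gradient (globalObj loss D)
      (colAvg (pisco loss D W x0 To ηl ηc Z c ω k).X)‖ ^ 2 ∂μ

/-- `E ‖Y^0 - Y^0 J‖_F²`, where `Y^0` is the stochastic gradient at `x^0 1ᵀ` over the initial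
mini-batch. -/
def initTrackingError {n d m b : ℕ} {S Ω : Type*} [MeasurableSpace Ω] (μ : Measure Ω)
    (loss : Vec d → S → ℝ) (D : Fin n → Fin m → S) (x0 : Vec d)
    (Z : Fin n → ℕ → ℕ → Ω → Fin b → Fin m) : ℝ :=
  ∫ ω, frobSq (stochGrad loss D (fun i => Z i 0 0 ω) (fun _ => x0) -
    mix (stochGrad loss D (fun i => Z i 0 0 ω) (fun _ => x0)) (avgMatrix n)) ∂μ

/-! ### Assumptions -/

/-- Each local objective is differentiable with an `L`-Lipschitz gradient. -/
def LSmooth {n d m : ℕ} {S : Type*} (loss : Vec d → S → ℝ) (D : Fin n → Fin m → S) (L : ℝ) :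
    Prop :=
  ∀ i, Differentiable ℝ (localObj loss (D i)) ∧
    ∀ x y, ‖gradient (localObj loss (D i)) x - gradient (localObj loss (D i)) y‖ ≤ L * ‖x - y‖

/-- The mini-batches and the coins are random variables, all of them mutually independent (over
agents and over draws), and each coin shows `true` with probability `p`. -/
structure IndependentDraws {n m b : ℕ} {Ω : Type*} [MeasurableSpace Ω] (μ : Measure Ω) (p : ℝ)
    (Z : Fin n → ℕ → ℕ → Ω → Fin b → Fin m) (c : ℕ → Ω → Bool) : Prop where
  measurable_batch : ∀ i k t, Measurable (Z i k t)
  measurable_coin : ∀ k, Measurable (c k)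
  indep : iIndep (Sum.elim
    (fun s : Fin n × ℕ × ℕ => MeasurableSpace.comap (Z s.1 s.2.1 s.2.2) inferInstance)
    (fun k : ℕ => MeasurableSpace.comap (c k) inferInstance)) μ
  coin_prob : ∀ k, μ.real {ω | c k ω = true} = p

/-- Every local stochastic gradient is unbiased, with variance at most `σ² / b`. -/
def UnbiasedBoundedVariance {n d m b : ℕ} {S Ω : Type*} [MeasurableSpace Ω] (μ : Measure Ω)
    (loss : Vec d → S → ℝ) (D : Fin n → Fin m → S) (σ : ℝ)
    (Z : Fin n → ℕ → ℕ → Ω → Fin b → Fin m) : Prop :=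
  ∀ i k t x,
    ∫ ω, batchGrad loss (D i) (Z i k t ω) x ∂μ = gradient (localObj loss (D i)) x ∧
    ∫ ω, ‖batchGrad loss (D i) (Z i k t ω) x - gradient (localObj loss (D i)) x‖ ^ 2 ∂μ
      ≤ σ ^ 2 / b

/-! ### Step sizes, size of `K`, and the rates

`lam` is the expected mixing rate `λ_p`, and `ft` is the initial gap `f(x^0) - f^⋆`. -/

/-- The communication step size `η_c = α √(1+p) λ_p`. -/
def commStepSize (p lam α : ℝ) : ℝ := α * √(1 + p) * lam

/-- The local step size: `1 / (α T_o)` times the minimum of three powers of `1/K`; for `p = 1` the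
second one, whose denominator vanishes, is `+∞` and drops out of the minimum. -/
def localStepSize (n b To : ℕ) (p lam L σ α ft : ℝ) (K : ℕ) : ℝ :=
  let A₁ := (n * b * To * ft / ((1 + p) * lam ^ 2 * L * σ ^ 2 * K)) ^ (1 / 2 : ℝ)
  let A₂ := (√(1 + p) * lam * b * ft / ((1 - p) * L ^ 2 * σ ^ 2 * K)) ^ (1 / 3 : ℝ)
  let A₃ := (α ^ 2 * b * ft / (√(1 + p) * lam * L ^ 2 * σ ^ 2 * K)) ^ (1 / 3 : ℝ)
  1 / (α * To) * (if p < 1 then min A₁ (min A₂ A₃) else min A₁ A₃)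

/-- `K` is sufficiently large. -/
def SufficientlyLarge (n b To : ℕ) (p lam L σ α ft : ℝ) (K : ℕ) : Prop :=
  360 ^ 2 * n * To * b * L * ft / ((1 + p) ^ 2 * lam ^ 4 * σ ^ 2) ≤ K ∧
  (p < 1 → 360 ^ 3 * b * L * ft / ((1 - p ^ 2) * lam ^ 2 * σ ^ 2) ≤ K) ∧
  360 ^ 3 * α ^ 2 * b * L * ft / ((1 + p) ^ 2 * lam ^ 4 * σ ^ 2) ≤ K

/-- The leading term `(L f̃ σ² / (n T_o b K))^{1/2}` of the rate. -/
def leadingRate (n b To : ℕ) (L σ ft : ℝ) (K : ℕ) : ℝ :=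
  (L * ft * σ ^ 2 / (n * To * b * K)) ^ (1 / 2 : ℝ)

/-- The rate; `E0` is the initial tracking error `E ‖Y^0 - Y^0 J‖_F²`. -/
def rate (n b To : ℕ) (p lam L σ α ft E0 : ℝ) (K : ℕ) : ℝ :=
  leadingRate n b To L σ ft K
    + (L * ft * σ / (α * √(1 + p) * lam * √b * K)) ^ (2 / 3 : ℝ)
    + (√(1 - p) * L * ft * σ / ((1 + p) * lam ^ 2 * √b * K)) ^ (2 / 3 : ℝ)
    + E0 / (n * K)

/-- The number of communication rounds for `ε`-accuracy, up to an absolute constant. -/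
def complexity (n b To : ℕ) (p lam L σ α ft E0 ε : ℝ) : ℝ :=
  L * ft * σ ^ 2 / (n * To * b * ε ^ 4)
    + L * ft * σ / (α * √(1 + p) * lam * √b * ε ^ 3)
    + √(1 - p) * L * ft * σ / ((1 + p) * lam ^ 2 * √b * ε ^ 3)
    + E0 / (n * ε ^ 2)

end PISCO

end

/-!
Write `s = √(1+p) λ_p`, `η = η_c η_l`, `T = T_o + 1` and let `A` be the minimum in the definition of
the local step size, so that `η_l = A / (α T_o)` and `η = s A / T_o`. Unfolding one round gives
`X^{k+1} = (X^k - η ∑_{t ≤ T_o} Y^{k+1,t}) W^k` and `Y^{k+1} = (Y^k + G^{k+1} - G^k) W^k`, with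
`Y^{k+1,t} = Y^k - G^k + G^{k+1,t}`. In particular the average of `Y` is always the average of `G`,
and the relaxation `1 - η_c`, which may be negative, plays no role of its own.

*Probability.* Every quantity is a function of finitely many draws with finitely many values, so
everything is integrable. A draw not yet used is independent of the state, and one may integrate
over it with the state held fixed (`DeterminedBy.integral_le_of_notMem`). This makes the gradient
noise orthogonal to the past and to the noise of other agents, and makes a mixing step contract the
expected squared deviation from the column average by the factor `1 - λ_p`.

*Recursions.* The consensus error, the tracking error, the client drift, the squared search
directions and the objective value satisfy coupled one-round inequalities (`consErr_succ_le`,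
`trackErr_succ_le`, `drift_le`, `dirSq_le`, `expObj_succ_le`). Summed over `K` rounds, they close up
provided `A ≤ s / (360 L)` (`gradSq_bound_of_coupled_bounds`), which a sufficiently large `K`
guarantees (`stepMin_le`). With `f̃` the initial gap and `w = σ² / b`, the average squared gradient
is at most a constant times
`f̃ / (s A K) + E_0 / (n K) + L s A w / (T_o n) + L² A² w / α² + (1 - p) L² A² w / s²`
(`average_gradSq_le`).

*Rates.* The three candidates for `A` balance the first term exactly against the third, the fifth
and the fourth one (`balance_noise`, `balance_consensus`, `balance_drift`), and the common values
are the terms of the rate. The complexity and the speedup follow by solving for `K` and by comparing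
powers of `K`. A vanishing initial gap is separate: the step size is then `0`, and the average stays
at the minimizer `x^0`.
-/

namespace PISCO

/-! ### Column stacks and mixing matrices -/

section NormInequalities

variable {E : Type*} [NormedAddCommGroup E]

lemma norm_add_sq_le_young (x y : E) {β : ℝ} (hβ : 0 < β) :
    ‖x + y‖ ^ 2 ≤ (1 + β) * ‖x‖ ^ 2 + (1 + 1 / β) * ‖y‖ ^ 2 := by
  have h1 : ‖x + y‖ ^ 2 ≤ (‖x‖ + ‖y‖) ^ 2 := by gcongr; exact norm_add_le x y
  have h2 : (1 + β) * ‖x‖ ^ 2 + (1 + 1 / β) * ‖y‖ ^ 2 - (‖x‖ + ‖y‖) ^ 2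
      = (β * ‖x‖ - ‖y‖) ^ 2 / β := by field_simp; ring
  have h3 : 0 ≤ (β * ‖x‖ - ‖y‖) ^ 2 / β := by positivity
  linarith

lemma norm_sum_sq_le {ι : Type*} (s : Finset ι) (x : ι → E) :
    ‖∑ i ∈ s, x i‖ ^ 2 ≤ s.card * ∑ i ∈ s, ‖x i‖ ^ 2 :=
  calc ‖∑ i ∈ s, x i‖ ^ 2 ≤ (∑ i ∈ s, ‖x i‖) ^ 2 := by gcongr; exact norm_sum_le s x
    _ ≤ _ := sq_sum_le_card_mul_sum_sq

lemma norm_add_sq_le_two (x y : E) : ‖x + y‖ ^ 2 ≤ 2 * ‖x‖ ^ 2 + 2 * ‖y‖ ^ 2 := by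
  have := norm_add_sq_le_young x y one_pos
  norm_num at this ⊢
  exact this

end NormInequalities

variable {n d : ℕ}

lemma frobSq_nonneg (X : Stack n d) : 0 ≤ frobSq X :=
  Finset.sum_nonneg fun _ _ => by positivity

@[simp] lemma frobSq_zero : frobSq (0 : Stack n d) = 0 := by simp [frobSq]

lemma frobSq_smul (a : ℝ) (X : Stack n d) : frobSq (a • X) = a ^ 2 * frobSq X := by
  simp [frobSq, norm_smul, mul_pow, Finset.mul_sum]

lemma frobSq_neg (X : Stack n d) : frobSq (-X) = frobSq X := by
  simp [frobSq]

lemma frobSq_add_le_young (X Y : Stack n d) {β : ℝ} (hβ : 0 < β) :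
    frobSq (X + Y) ≤ (1 + β) * frobSq X + (1 + 1 / β) * frobSq Y := by
  simp only [frobSq, Finset.mul_sum, ← Finset.sum_add_distrib]
  exact Finset.sum_le_sum fun i _ => norm_add_sq_le_young (X i) (Y i) hβ

lemma frobSq_sum_le {ι : Type*} (s : Finset ι) (X : ι → Stack n d) :
    frobSq (∑ r ∈ s, X r) ≤ s.card * ∑ r ∈ s, frobSq (X r) := by
  simp only [frobSq]
  rw [Finset.sum_comm, Finset.mul_sum]
  refine Finset.sum_le_sum fun i _ => ?_
  simpa using norm_sum_sq_le s fun r => X r i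

lemma frobSq_add_le_two (X Y : Stack n d) : frobSq (X + Y) ≤ 2 * frobSq X + 2 * frobSq Y := by
  have := frobSq_add_le_young X Y one_pos
  norm_num at this ⊢
  exact this

lemma frobSq_sub_le_two (X Y : Stack n d) : frobSq (X - Y) ≤ 2 * frobSq X + 2 * frobSq Y := by
  have := frobSq_add_le_two X (-Y)
  rwa [frobSq_neg, ← sub_eq_add_neg] at this

lemma frobSq_add_le_three (X Y Z : Stack n d) :
    frobSq (X + Y + Z) ≤ 3 * frobSq X + 3 * frobSq Y + 3 * frobSq Z := by
  have := frobSq_sum_le Finset.univ ![X, Y, Z]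
  simp [Fin.sum_univ_three] at this
  linarith

lemma frobSq_add_le_four (X Y Z V : Stack n d) :
    frobSq (X + Y + Z + V)
      ≤ 4 * frobSq X + 4 * frobSq Y + 4 * frobSq Z + 4 * frobSq V := by
  have := frobSq_sum_le Finset.univ ![X, Y, Z, V]
  simp [Fin.sum_univ_four] at this
  linarith

/-- The deviation `X (I - J)` of the columns of `X` from their average. -/
noncomputable def dev (X : Stack n d) : Stack n d := fun i => X i - colAvg X

lemma colAvg_add (X Y : Stack n d) : colAvg (X + Y) = colAvg X + colAvg Y := by
  simp [colAvg, Finset.sum_add_distrib, smul_add]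

lemma colAvg_sub (X Y : Stack n d) : colAvg (X - Y) = colAvg X - colAvg Y := by
  simp [colAvg, Finset.sum_sub_distrib, smul_sub]

lemma colAvg_smul (a : ℝ) (X : Stack n d) : colAvg (a • X) = a • colAvg X := by
  simp [colAvg, ← Finset.smul_sum, smul_comm a]

lemma colAvg_sum {ι : Type*} (s : Finset ι) (X : ι → Stack n d) :
    colAvg (∑ r ∈ s, X r) = ∑ r ∈ s, colAvg (X r) := by
  simp only [colAvg, Finset.sum_apply, Finset.smul_sum]
  exact Finset.sum_comm

lemma colAvg_const (hn : 0 < n) (v : Vec d) : colAvg (fun _ : Fin n => v) = v := by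
  have : (n : ℝ) ≠ 0 := by positivity
  simp only [colAvg, Finset.sum_const, Finset.card_univ, Fintype.card_fin]
  rw [← Nat.cast_smul_eq_nsmul ℝ, smul_smul, one_div, inv_mul_cancel₀ this, one_smul]

lemma dev_add (X Y : Stack n d) : dev (X + Y) = dev X + dev Y := by
  ext1 i; simp only [dev, colAvg_add, Pi.add_apply]; abel

lemma dev_sub (X Y : Stack n d) : dev (X - Y) = dev X - dev Y := by
  ext1 i; simp only [dev, colAvg_sub, Pi.sub_apply]; abel

lemma dev_const (hn : 0 < n) (v : Vec d) : dev (fun _ : Fin n => v) = 0 := by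
  ext1 i; simp [dev, colAvg_const hn]

lemma mix_add (X Y : Stack n d) (M : Matrix (Fin n) (Fin n) ℝ) :
    mix (X + Y) M = mix X M + mix Y M := by
  ext1 j; simp [mix, Finset.sum_add_distrib]

lemma mix_sub (X Y : Stack n d) (M : Matrix (Fin n) (Fin n) ℝ) :
    mix (X - Y) M = mix X M - mix Y M := by
  ext1 j; simp [mix, Finset.sum_sub_distrib, smul_sub]

lemma mix_matrix_sub (X : Stack n d) (M N : Matrix (Fin n) (Fin n) ℝ) :
    mix X (M - N) = mix X M - mix X N := by
  ext1 j; simp [mix, Finset.sum_sub_distrib, sub_smul]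

lemma mix_avgMatrix (X : Stack n d) : mix X (avgMatrix n) = fun _ => colAvg X := by
  ext1 j; simp [mix, avgMatrix, colAvg, Finset.smul_sum]

lemma sub_mix_avgMatrix (X : Stack n d) : X - mix X (avgMatrix n) = dev X := by
  rw [mix_avgMatrix]; rfl

lemma colAvg_mix {M : Matrix (Fin n) (Fin n) ℝ} (hM : ∀ i, ∑ j, M i j = 1) (X : Stack n d) :
    colAvg (mix X M) = colAvg X := by
  simp only [colAvg, mix]
  rw [Finset.sum_comm]
  simp [← Finset.sum_smul, hM]

lemma mix_const {M : Matrix (Fin n) (Fin n) ℝ} (hM : ∀ j, ∑ i, M i j = 1) (v : Vec d) :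
    mix (fun _ => v) M = fun _ => v := by
  ext1 j; simp [mix, ← Finset.sum_smul, hM]

lemma dev_mix {M : Matrix (Fin n) (Fin n) ℝ} (hr : ∀ i, ∑ j, M i j = 1)
    (hc : ∀ j, ∑ i, M i j = 1) (X : Stack n d) : dev (mix X M) = mix (dev X) M := by
  have h : dev X = X - fun _ => colAvg X := rfl
  rw [h, mix_sub, mix_const hc]
  ext1 i
  simp [dev, colAvg_mix hr]

lemma colAvg_dev (hn : 0 < n) (X : Stack n d) : colAvg (dev X) = 0 := by
  have h : dev X = X - fun _ => colAvg X := rfl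
  rw [h, colAvg_sub, colAvg_const hn, sub_self]

/-- Pythagoras: the deviation is orthogonal to the average. -/
lemma frobSq_eq_dev_add_colAvg (hn : 0 < n) (X : Stack n d) :
    frobSq X = frobSq (dev X) + n * ‖colAvg X‖ ^ 2 := by
  have h0 : ∑ i, dev X i = 0 := by
    have := colAvg_dev hn X
    simp only [colAvg, smul_eq_zero] at this
    rcases this with h | h
    · exact absurd h (by positivity)
    · exact h
  have h1 : ∀ i, ‖X i‖ ^ 2
      = ‖dev X i‖ ^ 2 + 2 * inner ℝ (dev X i) (colAvg X) + ‖colAvg X‖ ^ 2 := by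
    intro i
    rw [← norm_add_sq_real]
    simp [dev]
  simp only [frobSq, h1, Finset.sum_add_distrib, ← Finset.mul_sum, ← sum_inner, h0, inner_zero_left]
  simp

lemma frobSq_dev_le (hn : 0 < n) (X : Stack n d) : frobSq (dev X) ≤ frobSq X := by
  rw [frobSq_eq_dev_add_colAvg hn X]
  have : 0 ≤ (n : ℝ) * ‖colAvg X‖ ^ 2 := by positivity
  linarith

lemma norm_colAvg_sq_le (hn : 0 < n) (X : Stack n d) : n * ‖colAvg X‖ ^ 2 ≤ frobSq X := by
  rw [frobSq_eq_dev_add_colAvg hn X]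
  linarith [frobSq_nonneg (dev X)]

lemma avgMatrix_mem_doublyStochastic (hn : 0 < n) :
    avgMatrix n ∈ doublyStochastic ℝ (Fin n) := by
  have : (n : ℝ) ≠ 0 := by positivity
  rw [mem_doublyStochastic_iff_sum]
  refine ⟨fun i j => by simp [avgMatrix], fun i => ?_, fun i => ?_⟩ <;>
    simp [avgMatrix, this]

/-- Averaging the columns with doubly stochastic weights does not increase the norm (Jensen). -/
lemma frobSq_mix_le {M : Matrix (Fin n) (Fin n) ℝ} (hM : M ∈ doublyStochastic ℝ (Fin n))
    (X : Stack n d) : frobSq (mix X M) ≤ frobSq X := by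
  obtain ⟨h0, hr, hc⟩ := mem_doublyStochastic_iff_sum.1 hM
  have h1 : ∀ j, ‖mix X M j‖ ^ 2 ≤ ∑ i, M i j * ‖X i‖ ^ 2 := by
    intro j
    have h2 : ‖mix X M j‖ ≤ ∑ i, M i j * ‖X i‖ := by
      refine (norm_sum_le _ _).trans (Finset.sum_le_sum fun i _ => ?_)
      rw [norm_smul, Real.norm_of_nonneg (h0 i j)]
    calc ‖mix X M j‖ ^ 2 ≤ (∑ i, M i j * ‖X i‖) ^ 2 := by gcongr
      _ ≤ ∑ i, M i j * ‖X i‖ ^ 2 :=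
        Real.pow_arith_mean_le_arith_mean_pow _ _ _ (fun i _ => h0 i j) (hc j)
          (fun i _ => norm_nonneg _) 2
  calc frobSq (mix X M) ≤ ∑ j, ∑ i, M i j * ‖X i‖ ^ 2 := Finset.sum_le_sum fun j _ => h1 j
    _ = frobSq X := by
      rw [Finset.sum_comm]
      simp [← Finset.sum_mul, hr, frobSq]

lemma norm_toEuclideanCLM_transpose (M : Matrix (Fin n) (Fin n) ℝ) :
    ‖Matrix.toEuclideanCLM (n := Fin n) (𝕜 := ℝ) M.transpose‖
      = ‖Matrix.toEuclideanCLM (n := Fin n) (𝕜 := ℝ) M‖ := by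
  have h : M.transpose = star M := by
    ext i j; simp [Matrix.star_apply]
  rw [h, map_star, ContinuousLinearMap.star_eq_adjoint, LinearIsometryEquiv.norm_map]

lemma frobSq_mix_le_opNorm (X : Stack n d) (M : Matrix (Fin n) (Fin n) ℝ) :
    frobSq (mix X M)
      ≤ ‖Matrix.toEuclideanCLM (n := Fin n) (𝕜 := ℝ) M‖ ^ 2 * frobSq X := by
  -- apply `Mᵀ` to each of the `d` rows of the stack
  have h1 : ∀ a : Fin d, ∑ j, (mix X M j a) ^ 2
      ≤ ‖Matrix.toEuclideanCLM (n := Fin n) (𝕜 := ℝ) M‖ ^ 2 * ∑ i, (X i a) ^ 2 := by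
    intro a
    have h2 := (Matrix.toEuclideanCLM (n := Fin n) (𝕜 := ℝ) M.transpose).le_opNorm
      (WithLp.toLp 2 fun i => X i a)
    rw [norm_toEuclideanCLM_transpose] at h2
    have h3 := pow_le_pow_left₀ (norm_nonneg _) h2 2
    rw [mul_pow, EuclideanSpace.norm_sq_eq, EuclideanSpace.norm_sq_eq] at h3
    simp only [Matrix.toEuclideanCLM_toLp, Real.norm_eq_abs, sq_abs] at h3
    have h4 : ∀ j, mix X M j a = M.transpose.mulVec (fun i => X i a) j := fun j => by
      simp [mix, Matrix.mulVec, dotProduct]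
    simp only [h4]
    exact h3
  calc frobSq (mix X M) = ∑ a, ∑ j, (mix X M j a) ^ 2 := by
        simp only [frobSq, EuclideanSpace.norm_sq_eq, Real.norm_eq_abs, sq_abs]
        exact Finset.sum_comm
    _ ≤ ∑ a, ‖Matrix.toEuclideanCLM (n := Fin n) (𝕜 := ℝ) M‖ ^ 2 * ∑ i, (X i a) ^ 2 :=
        Finset.sum_le_sum fun a _ => h1 a
    _ = _ := by
        rw [← Finset.mul_sum, Finset.sum_comm]
        simp only [frobSq, EuclideanSpace.norm_sq_eq, Real.norm_eq_abs, sq_abs]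

/-- Mixing with `W` contracts the deviation by the factor `‖W - J‖`. -/
lemma frobSq_dev_mix_le (hn : 0 < n) {M : Matrix (Fin n) (Fin n) ℝ}
    (hM : M ∈ doublyStochastic ℝ (Fin n)) (X : Stack n d) :
    frobSq (dev (mix X M)) ≤ (1 - mixingRate M) * frobSq (dev X) := by
  obtain ⟨-, hr, hc⟩ := mem_doublyStochastic_iff_sum.1 hM
  have h : mix (dev X) M = mix (dev X) (M - avgMatrix n) := by
    rw [mix_matrix_sub, mix_avgMatrix, colAvg_dev hn]
    ext1 i; simp
  rw [dev_mix hr hc, h, mixingRate, sub_sub_cancel]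
  exact frobSq_mix_le_opNorm _ _

lemma norm_sub_avgMatrix_le_one (hn : 0 < n) {M : Matrix (Fin n) (Fin n) ℝ}
    (hM : M ∈ doublyStochastic ℝ (Fin n)) :
    ‖Matrix.toEuclideanCLM (n := Fin n) (𝕜 := ℝ) (M - avgMatrix n)‖ ≤ 1 := by
  refine ContinuousLinearMap.opNorm_le_bound _ zero_le_one fun x => ?_
  rw [one_mul]
  -- view `x` as a stack with a single row and mix it with `Mᵀ`
  let X : Stack n 1 := fun i => WithLp.toLp 2 fun _ => x i
  have hMt : M.transpose ∈ doublyStochastic ℝ (Fin n) := by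
    obtain ⟨h0, hr, hc⟩ := mem_doublyStochastic_iff_sum.1 hM
    exact mem_doublyStochastic_iff_sum.2 ⟨fun i j => h0 j i, hc, hr⟩
  obtain ⟨-, hr, -⟩ := mem_doublyStochastic_iff_sum.1 hMt
  have h1 : frobSq (dev (mix X M.transpose)) ≤ frobSq X :=
    (frobSq_dev_le hn _).trans (frobSq_mix_le hMt _)
  have h2 : frobSq X = ‖x‖ ^ 2 := by
    simp [frobSq, X, EuclideanSpace.norm_sq_eq]
  have h3 : frobSq (dev (mix X M.transpose))
      = ‖Matrix.toEuclideanCLM (n := Fin n) (𝕜 := ℝ) (M - avgMatrix n) x‖ ^ 2 := by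
    rw [EuclideanSpace.norm_sq_eq]
    refine Finset.sum_congr rfl fun i _ => ?_
    rw [dev, colAvg_mix hr, EuclideanSpace.norm_sq_eq]
    simp [mix, X, colAvg, avgMatrix, Matrix.ofLp_toEuclideanCLM, Matrix.mulVec, dotProduct,
      ← Finset.mul_sum]
  rw [h2, h3] at h1
  exact le_of_sq_le_sq h1 (norm_nonneg _)

lemma mixingRate_nonneg (hn : 0 < n) {M : Matrix (Fin n) (Fin n) ℝ}
    (hM : M ∈ doublyStochastic ℝ (Fin n)) : 0 ≤ mixingRate M := by
  have := norm_sub_avgMatrix_le_one hn hM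
  unfold mixingRate
  nlinarith [norm_nonneg (Matrix.toEuclideanCLM (n := Fin n) (𝕜 := ℝ) (M - avgMatrix n))]

lemma mixingRate_le_one (M : Matrix (Fin n) (Fin n) ℝ) : mixingRate M ≤ 1 := by
  unfold mixingRate
  nlinarith [sq_nonneg ‖Matrix.toEuclideanCLM (n := Fin n) (𝕜 := ℝ) (M - avgMatrix n)‖]

lemma one_sub_expectedMixingRate (p : ℝ) (M : Matrix (Fin n) (Fin n) ℝ) :
    1 - expectedMixingRate p M = (1 - p) * (1 - mixingRate M) := by
  unfold expectedMixingRate; ring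

lemma IsMixingMatrix.mem_doublyStochastic {G : SimpleGraph (Fin n)}
    {W : Matrix (Fin n) (Fin n) ℝ} (h : IsMixingMatrix G W) : W ∈ doublyStochastic ℝ (Fin n) :=
  mem_doublyStochastic_iff_sum.2 ⟨h.nonneg, h.row_sum, h.col_sum⟩

lemma commMatrix_mem_doublyStochastic (hn : 0 < n) {W : Matrix (Fin n) (Fin n) ℝ}
    (hW : W ∈ doublyStochastic ℝ (Fin n)) (q : Bool) :
    commMatrix W q ∈ doublyStochastic ℝ (Fin n) := by
  cases q
  · simpa [commMatrix] using hW
  · simpa [commMatrix] using avgMatrix_mem_doublyStochastic hn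

lemma frobSq_dev_mix_commMatrix_le (hn : 0 < n) {W : Matrix (Fin n) (Fin n) ℝ}
    (hW : W ∈ doublyStochastic ℝ (Fin n)) (q : Bool) (X : Stack n d) :
    frobSq (dev (mix X (commMatrix W q)))
      ≤ (if q then 0 else 1 - mixingRate W) * frobSq (dev X) := by
  cases q
  · simpa [commMatrix] using frobSq_dev_mix_le hn hW X
  · simp [commMatrix, mix_avgMatrix, dev_const hn]

/-! ### Pathwise form of the recursion -/

section Pathwise

variable {n d : ℕ} {ηl ηc : ℝ}

/-- Local updates telescope: the tracking variable is the gradient plus the frozen correction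
`Y^k - G^k`. -/
lemma localUpdates_Y (g : ℕ → Stack n d → Stack n d) (s : State n d) (t : ℕ) :
    (localUpdates ηl g s t).Y = s.Y - s.G + (localUpdates ηl g s t).G := by
  induction t with
  | zero => simp [localUpdates]
  | succ t ih =>
    simp only [localUpdates]
    rw [ih]; abel

lemma localUpdates_X (g : ℕ → Stack n d → Stack n d) (s : State n d) (t : ℕ) :
    (localUpdates ηl g s t).X
      = s.X - ηl • ∑ r ∈ Finset.range t, (localUpdates ηl g s r).Y := by
  induction t with
  | zero => simp [localUpdates]
  | succ t ih =>
    rw [Finset.sum_range_succ, smul_add, ← sub_sub, ← ih]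
    rfl

variable {To : ℕ} {x0 : Vec d} {Wk : ℕ → Matrix (Fin n) (Fin n) ℝ}
  {g : ℕ → ℕ → Stack n d → Stack n d}

lemma run_G (k : ℕ) :
    (run To ηl ηc x0 Wk g k).G = g k 0 (run To ηl ηc x0 Wk g k).X := by
  cases k <;> rfl

lemma run_succ_X (k : ℕ) :
    (run To ηl ηc x0 Wk g (k + 1)).X
      = mix ((run To ηl ηc x0 Wk g k).X - (ηc * ηl) • ∑ r ∈ Finset.range (To + 1),
          (localUpdates ηl (g (k + 1)) (run To ηl ηc x0 Wk g k) r).Y) (Wk k) := by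
  simp only [run, communicate]
  rw [localUpdates_X, Finset.sum_range_succ]
  congr 1
  module

lemma run_succ_Y (k : ℕ) :
    (run To ηl ηc x0 Wk g (k + 1)).Y
      = mix ((run To ηl ηc x0 Wk g k).Y + ((run To ηl ηc x0 Wk g (k + 1)).G
          - (run To ηl ηc x0 Wk g k).G)) (Wk k) := by
  rw [run_G (k + 1)]
  simp only [run, communicate]
  rw [localUpdates_Y]
  congr 1
  abel

/-- Gradient tracking: the average of the tracking variables is the average of the current
stochastic gradients. -/
lemma colAvg_run_Y (hW : ∀ k i, ∑ j, Wk k i j = 1) (k : ℕ) :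
    colAvg (run To ηl ηc x0 Wk g k).Y = colAvg (run To ηl ηc x0 Wk g k).G := by
  induction k with
  | zero => rfl
  | succ k ih =>
    rw [run_succ_Y, colAvg_mix (hW k), colAvg_add, colAvg_sub, ih]
    abel

end Pathwise

/-! ### Smooth objectives -/

section Smooth

variable {E : Type*} [NormedAddCommGroup E] [InnerProductSpace ℝ E] [CompleteSpace E]

/-- The descent lemma for a function with Lipschitz gradient. -/
lemma le_add_inner_gradient_of_lipschitz {f : E → ℝ} {L : ℝ} (hf : Differentiable ℝ f)
    (hL : ∀ x y, ‖gradient f x - gradient f y‖ ≤ L * ‖x - y‖) (x v : E) :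
    f (x + v) ≤ f x + inner ℝ (gradient f x) v + L / 2 * ‖v‖ ^ 2 := by
  -- compare `t ↦ f (x + t v)` with the quadratic on `[0, 1]` by their derivatives
  have hd : ∀ t : ℝ, HasDerivAt (fun t : ℝ => f (x + t • v))
      (inner ℝ (gradient f (x + t • v)) v) t := by
    intro t
    have h1 : HasDerivAt (fun t : ℝ => x + t • v) v t := by
      simpa using ((hasDerivAt_id t).smul_const v).const_add x
    have h2 := (hf (x + t • v)).hasFDerivAt.comp_hasDerivAt t h1
    rwa [← inner_gradient_left] at h2
  have hB : ∀ t : ℝ, HasDerivAt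
      (fun t : ℝ => f x + t * inner ℝ (gradient f x) v + L / 2 * ‖v‖ ^ 2 * t ^ 2)
      (inner ℝ (gradient f x) v + L * ‖v‖ ^ 2 * t) t := by
    intro t
    have h1 := ((hasDerivAt_id t).mul_const (inner ℝ (gradient f x) v)).const_add (f x)
    have h2 := (hasDerivAt_pow 2 t).const_mul (L / 2 * ‖v‖ ^ 2)
    refine (h1.add h2).congr_deriv ?_
    simp
    ring
  have key := image_le_of_deriv_right_le_deriv_boundary (a := (0 : ℝ)) (b := 1)
    (fun t _ => (hd t).continuousAt.continuousWithinAt) (fun t _ => (hd t).hasDerivWithinAt)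
    (by simp) (fun t _ => (hB t).continuousAt.continuousWithinAt)
    (fun t _ => (hB t).hasDerivWithinAt) (fun t ht => ?_)
    (Set.right_mem_Icc.2 (zero_le_one (α := ℝ)))
  · simpa using key
  · have h1 : inner ℝ (gradient f (x + t • v) - gradient f x) v ≤ L * ‖v‖ ^ 2 * t :=
      calc inner ℝ (gradient f (x + t • v) - gradient f x) v
          ≤ ‖gradient f (x + t • v) - gradient f x‖ * ‖v‖ := real_inner_le_norm _ _
        _ ≤ (L * ‖x + t • v - x‖) * ‖v‖ := by gcongr; exact hL _ _
        _ = L * ‖v‖ ^ 2 * t := by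
          rw [add_sub_cancel_left, norm_smul, Real.norm_of_nonneg ht.1]; ring
    rw [inner_sub_left] at h1
    linarith

end Smooth

section Objective

variable {n d m : ℕ} {S : Type*} {loss : Vec d → S → ℝ} {D : Fin n → Fin m → S} {L : ℝ}

/-- The stack `∇F(X)` of the local gradients, agent `i` at its own column of `X`. -/
noncomputable def gradStack (loss : Vec d → S → ℝ) (D : Fin n → Fin m → S) (X : Stack n d) :
    Stack n d :=
  fun i => gradient (localObj loss (D i)) (X i)

lemma LSmooth.hasGradientAt_globalObj (h : LSmooth loss D L) (x : Vec d) :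
    HasGradientAt (globalObj loss D) (colAvg (gradStack loss D fun _ => x)) x := by
  rw [hasGradientAt_iff_hasFDerivAt]
  have h1 : HasFDerivAt (fun y => ∑ i, localObj loss (D i) y)
      (∑ i, fderiv ℝ (localObj loss (D i)) x) x :=
    HasFDerivAt.fun_sum fun i _ => ((h i).1 x).hasFDerivAt
  have h2 := h1.const_mul (1 / (n : ℝ))
  refine h2.congr_fderiv ?_
  simp only [colAvg, gradStack, map_smul, map_sum, toDual_gradient]

lemma LSmooth.gradient_globalObj (h : LSmooth loss D L) (x : Vec d) :
    gradient (globalObj loss D) x = colAvg (gradStack loss D fun _ => x) :=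
  (h.hasGradientAt_globalObj x).gradient

lemma LSmooth.differentiable_globalObj (h : LSmooth loss D L) :
    Differentiable ℝ (globalObj loss D) :=
  fun x => (h.hasGradientAt_globalObj x).differentiableAt

lemma LSmooth.frobSq_gradStack_sub_le (h : LSmooth loss D L) (X X' : Stack n d) :
    frobSq (gradStack loss D X - gradStack loss D X') ≤ L ^ 2 * frobSq (X - X') := by
  rw [frobSq, frobSq, Finset.mul_sum]
  refine Finset.sum_le_sum fun i _ => ?_
  rw [← mul_pow]
  exact pow_le_pow_left₀ (norm_nonneg _) ((h i).2 _ _) 2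

lemma LSmooth.lipschitz_gradient_globalObj (hn : 0 < n) (hL : 0 ≤ L) (h : LSmooth loss D L)
    (x y : Vec d) :
    ‖gradient (globalObj loss D) x - gradient (globalObj loss D) y‖ ≤ L * ‖x - y‖ := by
  have hn' : (0 : ℝ) < n := by positivity
  rw [h.gradient_globalObj, h.gradient_globalObj, ← colAvg_sub]
  have h1 := norm_colAvg_sq_le hn
    (gradStack loss D (fun _ => x) - gradStack loss D (fun _ => y))
  have h2 := h.frobSq_gradStack_sub_le (fun _ => x) (fun _ => y)
  have h3 : frobSq ((fun _ => x) - (fun _ => y) : Stack n d) = n * ‖x - y‖ ^ 2 := by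
    simp [frobSq]
  rw [h3] at h2
  refine le_of_sq_le_sq ?_ (by positivity)
  rw [mul_pow]
  refine le_of_mul_le_mul_left ?_ hn'
  linarith

/-- Averaged local gradients against the global gradient at the average point. -/
lemma LSmooth.norm_gradient_sub_colAvg_sq_le (hn : 0 < n) (h : LSmooth loss D L) (X X' : Stack n d) :
    n * ‖gradient (globalObj loss D) (colAvg X) - colAvg (gradStack loss D X')‖ ^ 2
      ≤ 2 * L ^ 2 * (frobSq (dev X) + frobSq (X' - X)) := by
  rw [h.gradient_globalObj, ← colAvg_sub]
  refine (norm_colAvg_sq_le hn _).trans ((h.frobSq_gradStack_sub_le _ _).trans ?_)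
  have h1 : ((fun _ => colAvg X) - X' : Stack n d) = -(dev X + (X' - X)) := by
    ext1 i; simp only [dev, Pi.sub_apply, Pi.add_apply, Pi.neg_apply]; abel
  rw [h1, frobSq_neg]
  have := frobSq_add_le_two (dev X) (X' - X)
  nlinarith [sq_nonneg L]

end Objective

/-! ### Functions of finitely many finite-valued independent draws -/

section Draws

variable {Ω ι Q γ δ : Type*}

/-- `V` is a function of the draws `src i` with `i ∈ T`. -/
def DeterminedBy (src : ι → Ω → Q) (T : Set ι) (V : Ω → γ) : Prop :=
  ∀ ω ω', (∀ i ∈ T, src i ω = src i ω') → V ω = V ω'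

namespace DeterminedBy

variable {src : ι → Ω → Q} {T T' : Set ι} {V : Ω → γ} {V' : Ω → δ}

lemma mono (h : DeterminedBy src T V) (hT : T ⊆ T') : DeterminedBy src T' V :=
  fun ω ω' h' => h ω ω' fun i hi => h' i (hT hi)

lemma const (v : γ) : DeterminedBy src T fun _ => v := fun _ _ _ => rfl

lemma comp (h : DeterminedBy src T V) (f : γ → δ) : DeterminedBy src T fun ω => f (V ω) :=
  fun ω ω' h' => congrArg f (h ω ω' h')

lemma prodMk (h : DeterminedBy src T V) (h' : DeterminedBy src T V') :
    DeterminedBy src T fun ω => (V ω, V' ω) :=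
  fun ω ω' e => Prod.ext (h ω ω' e) (h' ω ω' e)

lemma exists_factor [Nonempty γ] (hT : T.Finite) (h : DeterminedBy src T V) :
    ∃ φ : (hT.toFinset → Q) → γ, V = φ ∘ fun ω (i : hT.toFinset) => src i ω := by
  refine (Function.factorsThrough_iff _).1 fun ω ω' e => h ω ω' fun i hi => ?_
  exact congrFun e ⟨i, hT.mem_toFinset.2 hi⟩

variable [Finite Q] [MeasurableSpace Q] [MeasurableSingletonClass Q]
  [MeasurableSpace Ω] {μ : Measure Ω}

lemma integrable {E : Type*} [NormedAddCommGroup E] [IsFiniteMeasure μ] {V : Ω → E}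
    (hm : ∀ i, Measurable (src i)) (hT : T.Finite) (h : DeterminedBy src T V) :
    Integrable V μ := by
  obtain ⟨φ, rfl⟩ := h.exists_factor hT
  have hA : Measurable fun ω (i : hT.toFinset) => src i ω := measurable_pi_lambda _ fun i => hm i
  exact (Integrable.of_finite (μ := μ.map fun ω (i : hT.toFinset) => src i ω)).comp_measurable hA

/-- Conditioning on the past: if `V` is a function of draws other than `j`, then a bound for the
expectation over the draw `j` with `V` held fixed may be integrated over `V`. -/
lemma integral_le_of_notMem [IsProbabilityMeasure μ] (hm : ∀ i, Measurable (src i))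
    (hind : iIndepFun src μ) (hT : T.Finite) (h : DeterminedBy src T V) {j : ι} (hj : j ∉ T)
    (f : γ → Q → ℝ) (u : γ → ℝ) (hfu : ∀ v, ∫ ω, f v (src j ω) ∂μ ≤ u v) :
    ∫ ω, f (V ω) (src j ω) ∂μ ≤ ∫ ω, u (V ω) ∂μ := by
  have : Nonempty Ω := nonempty_of_isProbabilityMeasure μ
  have : Nonempty γ := this.map V
  obtain ⟨φ, rfl⟩ := h.exists_factor hT
  set A : Ω → hT.toFinset → Q := fun ω i => src i ω
  have hA : Measurable A := measurable_pi_lambda _ fun i => hm i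
  have hAB : IndepFun A (src j) μ := by
    have h1 := iIndepFun.indepFun_finset hT.toFinset {j}
      (by simpa using hj) hind hm
    exact h1.comp (φ := id)
      (ψ := fun a : ({j} : Finset ι) → Q => a ⟨j, Finset.mem_singleton_self j⟩) measurable_id
      (by fun_prop)
  have hpA : IsProbabilityMeasure (μ.map A) := Measure.isProbabilityMeasure_map hA.aemeasurable
  have hpB : IsProbabilityMeasure (μ.map (src j)) :=
    Measure.isProbabilityMeasure_map (hm j).aemeasurable
  have hmap := (indepFun_iff_map_prod_eq_prod_map_map hA.aemeasurable (hm j).aemeasurable).1 hAB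
  have e1 : ∫ ω, f (φ (A ω)) (src j ω) ∂μ
      = ∫ z, f (φ z.1) z.2 ∂((μ.map A).prod (μ.map (src j))) := by
    rw [← hmap, integral_map (hA.prodMk (hm j)).aemeasurable (by fun_prop)]
  have e2 : ∫ ω, u (φ (A ω)) ∂μ = ∫ a, u (φ a) ∂(μ.map A) := by
    rw [integral_map hA.aemeasurable (by fun_prop)]
  simp only [Function.comp]
  rw [e1, e2, integral_prod _ Integrable.of_finite]
  refine integral_mono Integrable.of_finite Integrable.of_finite fun a => ?_
  have e3 : ∫ q, f (φ a) q ∂(μ.map (src j)) = ∫ ω, f (φ a) (src j ω) ∂μ := by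
    rw [integral_map (hm j).aemeasurable (by fun_prop)]
  simpa only [e3] using hfu (φ a)

end DeterminedBy

end Draws

/-! ### The algorithm as a function of its draws -/

/-- The data that determine a run of the algorithm. -/
structure Model (n d m b : ℕ) (S Ω : Type*) where
  loss : Vec d → S → ℝ
  D : Fin n → Fin m → S
  W : Matrix (Fin n) (Fin n) ℝ
  x0 : Vec d
  To : ℕ
  ηl : ℝ
  ηc : ℝ
  Z : Fin n → ℕ → ℕ → Ω → Fin b → Fin m
  c : ℕ → Ω → Bool

namespace Model

variable {n d m b : ℕ} {S Ω : Type*} (M : Model n d m b S Ω)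

/-- All mini-batches and coins, as one family. -/
def draw : (Fin n × ℕ × ℕ) ⊕ ℕ → Ω → (Fin b → Fin m) ⊕ Bool
  | .inl s => fun ω => .inl (M.Z s.1 s.2.1 s.2.2 ω)
  | .inr k => fun ω => .inr (M.c k ω)

/-- The time at which a draw is used: round `k` occupies the times from `k (T_o + 2)` on, one for
each of the `T_o + 1` gradient evaluations that enter its local phase, and the last one for its
coin. The gradient at `X^k` carries the index `(k, 0)` and belongs to round `k`, while the local
evaluations of round `k` carry the indices `(k + 1, t)` with `t ≥ 1`. -/
def time : (Fin n × ℕ × ℕ) ⊕ ℕ → ℕ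
  | .inl s => (if s.2.2 = 0 then s.2.1 else s.2.1 - 1) * (M.To + 2) + s.2.2
  | .inr k => k * (M.To + 2) + (M.To + 1)

/-- The draws used before time `N`. -/
def past (N : ℕ) : Set ((Fin n × ℕ × ℕ) ⊕ ℕ) := {i | M.time i < N}

/-- The state after `k` rounds. -/
noncomputable def state (k : ℕ) (ω : Ω) : State n d :=
  pisco M.loss M.D M.W M.x0 M.To M.ηl M.ηc M.Z M.c ω k

/-- The state after `t` local updates of round `k`. -/
noncomputable def localState (k t : ℕ) (ω : Ω) : State n d :=
  localUpdates M.ηl (fun t => stochGrad M.loss M.D (fun i => M.Z i (k + 1) t ω)) (M.state k ω) t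

/-- The index of the mini-batches behind the gradient held after `t` local updates of round `k`. -/
def batchIdx (k t : ℕ) : ℕ × ℕ := if t = 0 then (k, 0) else (k + 1, t)

/-- The error of the stochastic gradients held after `t` local updates of round `k`. -/
noncomputable def noise (k t : ℕ) (ω : Ω) : Stack n d :=
  (M.localState k t ω).G - gradStack M.loss M.D (M.localState k t ω).X

lemma localState_zero (k : ℕ) (ω : Ω) : M.localState k 0 ω = M.state k ω := rfl

lemma localState_G (k t : ℕ) (ω : Ω) :
    (M.localState k t ω).G = stochGrad M.loss M.D
      (fun i => M.Z i (batchIdx k t).1 (batchIdx k t).2 ω) (M.localState k t ω).X := by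
  cases t with
  | zero => exact run_G k
  | succ t => rfl

lemma noise_apply (k t : ℕ) (ω : Ω) (i : Fin n) :
    M.noise k t ω i = batchGrad M.loss (M.D i)
      (M.Z i (batchIdx k t).1 (batchIdx k t).2 ω) ((M.localState k t ω).X i)
        - gradient (localObj M.loss (M.D i)) ((M.localState k t ω).X i) := by
  rw [noise, localState_G]; rfl

lemma localState_Y (k t : ℕ) (ω : Ω) :
    (M.localState k t ω).Y
      = (M.state k ω).Y - (M.state k ω).G + (M.localState k t ω).G :=
  localUpdates_Y _ _ _

lemma localState_X (k t : ℕ) (ω : Ω) :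
    (M.localState k t ω).X
      = (M.state k ω).X - M.ηl • ∑ r ∈ Finset.range t, (M.localState k r ω).Y :=
  localUpdates_X _ _ _

lemma state_succ_X (k : ℕ) (ω : Ω) :
    (M.state (k + 1) ω).X = mix ((M.state k ω).X - (M.ηc * M.ηl) •
      ∑ r ∈ Finset.range (M.To + 1), (M.localState k r ω).Y) (commMatrix M.W (M.c k ω)) :=
  run_succ_X k

lemma state_succ_Y (k : ℕ) (ω : Ω) :
    (M.state (k + 1) ω).Y = mix ((M.state k ω).Y + ((M.state (k + 1) ω).G - (M.state k ω).G))
      (commMatrix M.W (M.c k ω)) :=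
  run_succ_Y k

lemma time_batchIdx (i : Fin n) (k t : ℕ) :
    M.time (.inl (i, batchIdx k t)) = k * (M.To + 2) + t := by
  cases t <;> simp [time, batchIdx]

lemma past_mono {N N' : ℕ} (h : N ≤ N') : M.past N ⊆ M.past N' :=
  fun _ hi => lt_of_lt_of_le hi h

lemma finite_past (N : ℕ) : (M.past N).Finite := by
  refine Set.Finite.subset
    (s := Sum.inl '' (Set.univ ×ˢ (Set.Iic N ×ˢ Set.Iic N)) ∪ Sum.inr '' Set.Iic N)
    (((Set.finite_univ.prod ((Set.finite_Iic N).prod (Set.finite_Iic N))).image _).union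
      ((Set.finite_Iic N).image _)) ?_
  rintro (⟨i, k, t⟩ | k) hi
  · refine Or.inl ⟨(i, k, t), ?_, rfl⟩
    simp only [past, time, Set.mem_ofPred_eq] at hi
    simp only [Set.mem_prod, Set.mem_univ, Set.mem_Iic, true_and]
    split_ifs at hi with h0
    · constructor <;> nlinarith
    · have : k - 1 ≤ (k - 1) * (M.To + 2) := Nat.le_mul_of_pos_right _ (by omega)
      omega
  · refine Or.inr ⟨k, ?_, rfl⟩
    simp only [past, time, Set.mem_ofPred_eq] at hi
    have : k ≤ k * (M.To + 2) := Nat.le_mul_of_pos_right _ (by omega)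
    simp only [Set.mem_Iic]
    omega

lemma Z_eq_of_draw_eq {ω ω' : Ω} {k t N : ℕ} (hN : k * (M.To + 2) + t < N)
    (e : ∀ i ∈ M.past N, M.draw i ω = M.draw i ω') (i : Fin n) :
    M.Z i (batchIdx k t).1 (batchIdx k t).2 ω = M.Z i (batchIdx k t).1 (batchIdx k t).2 ω' := by
  have := e (.inl (i, batchIdx k t)) (by simpa [past, time_batchIdx] using hN)
  simpa [draw] using this

lemma c_eq_of_draw_eq {ω ω' : Ω} {k N : ℕ} (hN : k * (M.To + 2) + (M.To + 1) < N)
    (e : ∀ i ∈ M.past N, M.draw i ω = M.draw i ω') : M.c k ω = M.c k ω' := by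
  have := e (.inr k) (by simpa [past, time] using hN)
  simpa [draw] using this

lemma batch_notMem_past (i : Fin n) (k t : ℕ) :
    .inl (i, batchIdx k t) ∉ M.past (k * (M.To + 2) + t) := by
  simp [past, time_batchIdx]

lemma determinedBy_localState_of_state {k : ℕ}
    (h : DeterminedBy M.draw (M.past (k * (M.To + 2) + 1)) (M.state k)) (t : ℕ) :
    DeterminedBy M.draw (M.past (k * (M.To + 2) + t + 1)) (M.localState k t) := by
  induction t with
  | zero => exact h
  | succ t ih =>
    intro ω ω' e
    have e1 : M.localState k t ω = M.localState k t ω' :=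
      ih ω ω' fun i hi => e i (M.past_mono (by omega) hi)
    have e2 := M.Z_eq_of_draw_eq (k := k) (t := t + 1) (by omega) e
    simp only [batchIdx, Nat.succ_ne_zero, if_false] at e2
    simp only [localState] at e1
    simp only [localState, localUpdates, e1, e2]

lemma determinedBy_state_X_of_state {k : ℕ}
    (h : DeterminedBy M.draw (M.past (k * (M.To + 2) + 1)) (M.state k)) :
    DeterminedBy M.draw (M.past ((k + 1) * (M.To + 2))) (fun ω => (M.state (k + 1) ω).X) := by
  intro ω ω' e
  have hk : (k + 1) * (M.To + 2) = k * (M.To + 2) + (M.To + 2) := by ring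
  have e0 : M.state k ω = M.state k ω' :=
    h ω ω' fun i hi => e i (M.past_mono (by omega) hi)
  have e1 : ∀ r ∈ Finset.range (M.To + 1), (M.localState k r ω).Y = (M.localState k r ω').Y := by
    intro r hr
    rw [Finset.mem_range] at hr
    rw [M.determinedBy_localState_of_state h r ω ω'
      fun i hi => e i (M.past_mono (by omega) hi)]
  have e2 := M.c_eq_of_draw_eq (k := k) (by omega) e
  simp only [state_succ_X]
  rw [e0, e2, Finset.sum_congr rfl e1]

lemma determinedBy_state (k : ℕ) :
    DeterminedBy M.draw (M.past (k * (M.To + 2) + 1)) (M.state k) := by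
  induction k with
  | zero =>
    intro ω ω' e
    have e2 := M.Z_eq_of_draw_eq (k := 0) (t := 0) (by omega) e
    simp only [batchIdx, if_true] at e2
    simp only [state, pisco, run, e2]
  | succ k ih =>
    intro ω ω' e
    have hk : (k + 1) * (M.To + 2) = k * (M.To + 2) + (M.To + 2) := by ring
    have e0 : M.state k ω = M.state k ω' :=
      ih ω ω' fun i hi => e i (M.past_mono (by omega) hi)
    have eX : (M.state (k + 1) ω).X = (M.state (k + 1) ω').X :=
      M.determinedBy_state_X_of_state ih ω ω' fun i hi => e i (M.past_mono (by omega) hi)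
    have eG : (M.state (k + 1) ω).G = (M.state (k + 1) ω').G := by
      have h1 := M.localState_G (k + 1) 0 ω
      have h2 := M.localState_G (k + 1) 0 ω'
      rw [localState_zero] at h1 h2
      rw [h1, h2, eX]
      simp only [M.Z_eq_of_draw_eq (k := k + 1) (t := 0) (by omega) e]
    have eY : (M.state (k + 1) ω).Y = (M.state (k + 1) ω').Y := by
      rw [state_succ_Y, state_succ_Y, eG, e0, M.c_eq_of_draw_eq (k := k) (by omega) e]
    generalize M.state (k + 1) ω = s at *
    generalize M.state (k + 1) ω' = s' at *
    cases s; cases s'; simp_all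

lemma determinedBy_localState (k t : ℕ) :
    DeterminedBy M.draw (M.past (k * (M.To + 2) + t + 1)) (M.localState k t) :=
  M.determinedBy_localState_of_state (M.determinedBy_state k) t

/-- Gradients are evaluated with mini-batches that are independent of the evaluation point. -/
lemma determinedBy_localState_X (k t : ℕ) :
    DeterminedBy M.draw (M.past (k * (M.To + 2) + t)) (fun ω => (M.localState k t ω).X) := by
  cases t with
  | zero =>
    cases k with
    | zero => exact DeterminedBy.const _
    | succ k => exact M.determinedBy_state_X_of_state (M.determinedBy_state k)
  | succ t =>
    intro ω ω' e
    have e1 : M.localState k t ω = M.localState k t ω' := M.determinedBy_localState k t ω ω' e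
    simp only [localState] at e1
    simp only [localState, localUpdates, e1]

lemma determinedBy_noise (k t : ℕ) :
    DeterminedBy M.draw (M.past (k * (M.To + 2) + t + 1)) (M.noise k t) :=
  (M.determinedBy_localState k t).comp fun s => s.G - gradStack M.loss M.D s.X

end Model

/-! ### Moments of the gradient noise and of the random mixing step -/

lemma integral_le_sum_mul_integral {Ω : Type*} [MeasurableSpace Ω] {μ : Measure Ω} {V : Ω → ℝ}
    {r : ℕ} (a : Fin r → ℝ) (f : Fin r → Ω → ℝ) (hV : Integrable V μ)
    (hf : ∀ i, Integrable (f i) μ) (hle : ∀ ω, V ω ≤ ∑ i, a i * f i ω) :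
    ∫ ω, V ω ∂μ ≤ ∑ i, a i * ∫ ω, f i ω ∂μ := by
  calc ∫ ω, V ω ∂μ ≤ ∫ ω, ∑ i, a i * f i ω ∂μ :=
        integral_mono hV (integrable_finsetSum _ fun i _ => (hf i).const_mul _) hle
    _ = _ := by
        rw [integral_finsetSum _ fun i _ => (hf i).const_mul _]
        simp only [integral_const_mul]

/-- The second moment of a sum of pairwise orthogonal random vectors. -/
lemma integral_norm_sum_sq_of_orthogonal {Ω κ E : Type*} [MeasurableSpace Ω] {μ : Measure Ω}
    [NormedAddCommGroup E] [InnerProductSpace ℝ E] [DecidableEq κ] (s : Finset κ) (e : κ → Ω → E)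
    (hi : ∀ r ∈ s, ∀ r' ∈ s, Integrable (fun ω => inner ℝ (e r ω) (e r' ω)) μ)
    (h0 : ∀ r ∈ s, ∀ r' ∈ s, r ≠ r' → ∫ ω, inner ℝ (e r ω) (e r' ω) ∂μ = 0) :
    ∫ ω, ‖∑ r ∈ s, e r ω‖ ^ 2 ∂μ = ∑ r ∈ s, ∫ ω, ‖e r ω‖ ^ 2 ∂μ := by
  have h1 : ∀ ω, ‖∑ r ∈ s, e r ω‖ ^ 2 = ∑ r ∈ s, ∑ r' ∈ s, inner ℝ (e r ω) (e r' ω) := by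
    intro ω
    rw [← real_inner_self_eq_norm_sq, sum_inner]
    simp only [inner_sum]
  simp only [h1]
  rw [integral_finsetSum _ fun r hr => integrable_finsetSum _ fun r' hr' => hi r hr r' hr']
  refine Finset.sum_congr rfl fun r hr => ?_
  rw [integral_finsetSum _ fun r' hr' => hi r hr r' hr', Finset.sum_eq_single_of_mem r hr]
  · simp only [real_inner_self_eq_norm_sq]
  · exact fun r' hr' hne => h0 r hr r' hr' hne.symm

instance {α β : Type*} [MeasurableSpace α] [MeasurableSpace β] [MeasurableSingletonClass α]
    [MeasurableSingletonClass β] : MeasurableSingletonClass (α ⊕ β) where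
  measurableSet_singleton
    | .inl a => by
      rw [← Set.image_singleton]; exact (measurableSet_singleton a).inl_image
    | .inr a => by
      rw [← Set.image_singleton]; exact (measurableSet_singleton a).inr_image

namespace Model

variable {n d m b : ℕ} {S Ω : Type*} [MeasurableSpace Ω]

/-- The standing assumptions on network, objective, draws and gradient noise. -/
structure Admissible (M : Model n d m b S Ω) (μ : Measure Ω) (p L σ : ℝ) : Prop where
  agents_pos : 0 < n
  batch_pos : 0 < b
  prob_nonneg : 0 ≤ p
  prob_le_one : p ≤ 1
  doublyStochastic : M.W ∈ doublyStochastic ℝ (Fin n)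
  rate_pos : 0 < expectedMixingRate p M.W
  smoothness_pos : 0 < L
  smooth : LSmooth M.loss M.D L
  draws : IndependentDraws μ p M.Z M.c
  variance : UnbiasedBoundedVariance μ M.loss M.D σ M.Z

namespace Admissible

variable {M : Model n d m b S Ω} {μ : Measure Ω} {p L σ : ℝ}

lemma measurable_draw (h : M.Admissible μ p L σ) (i : (Fin n × ℕ × ℕ) ⊕ ℕ) :
    Measurable (M.draw i) := by
  cases i with
  | inl s => exact measurable_inl.comp (h.draws.measurable_batch _ _ _)
  | inr k => exact measurable_inr.comp (h.draws.measurable_coin _)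

lemma iIndepFun_draw (h : M.Admissible μ p L σ) : iIndepFun M.draw μ := by
  rw [iIndepFun_iff_iIndep]
  convert h.draws.indep using 1
  ext1 i
  cases i with
  | inl s =>
    ext t
    constructor
    · rintro ⟨u, -, rfl⟩
      exact ⟨Sum.inl ⁻¹' u, .of_discrete, rfl⟩
    · rintro ⟨u, -, rfl⟩
      refine ⟨Sum.inl '' u, .of_discrete, ?_⟩
      ext ω; simp [draw]
  | inr k =>
    ext t
    constructor
    · rintro ⟨u, -, rfl⟩
      exact ⟨Sum.inr ⁻¹' u, .of_discrete, rfl⟩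
    · rintro ⟨u, -, rfl⟩
      refine ⟨Sum.inr '' u, .of_discrete, ?_⟩
      ext ω; simp [draw]

variable [IsProbabilityMeasure μ]

lemma integrable (h : M.Admissible μ p L σ) {E : Type*} [NormedAddCommGroup E] {N : ℕ} {V : Ω → E}
    (hV : DeterminedBy M.draw (M.past N) V) : Integrable V μ :=
  hV.integrable h.measurable_draw (M.finite_past N)

lemma integrable_batch (h : M.Admissible μ p L σ) {E : Type*} [NormedAddCommGroup E] (i : Fin n)
    (k t : ℕ) (f : (Fin b → Fin m) → E) : Integrable (fun ω => f (M.Z i k t ω)) μ :=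
  (Integrable.of_finite (μ := μ.map (M.Z i k t))).comp_measurable (h.draws.measurable_batch i k t)

/-- Gradient noise is orthogonal to everything that does not depend on its own mini-batch. -/
lemma integral_inner_noise_eq_zero (h : M.Admissible μ p L σ) {k t : ℕ} {i : Fin n}
    {T : Set ((Fin n × ℕ × ℕ) ⊕ ℕ)} (hT : T.Finite) (hpast : M.past (k * (M.To + 2) + t) ⊆ T)
    (hi : .inl (i, batchIdx k t) ∉ T) {U : Ω → Vec d} (hU : DeterminedBy M.draw T U) :
    ∫ ω, inner ℝ (U ω) (M.noise k t ω i) ∂μ = 0 := by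
  have hUX := hU.prodMk ((M.determinedBy_localState_X k t).mono hpast)
  have hzero : ∀ v : Vec d × Stack n d, ∫ ω, inner ℝ v.1
      (batchGrad M.loss (M.D i) (M.Z i (batchIdx k t).1 (batchIdx k t).2 ω) (v.2 i)
        - gradient (localObj M.loss (M.D i)) (v.2 i)) ∂μ = 0 := by
    intro v
    have hint := h.integrable_batch i (batchIdx k t).1 (batchIdx k t).2 fun z =>
      batchGrad M.loss (M.D i) z (v.2 i) - gradient (localObj M.loss (M.D i)) (v.2 i)
    rw [integral_inner hint, integral_sub (h.integrable_batch i _ _ fun z =>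
      batchGrad M.loss (M.D i) z (v.2 i)) (integrable_const _), (h.variance i _ _ _).1]
    simp
  simp only [noise_apply]
  apply le_antisymm
  · have := hUX.integral_le_of_notMem h.measurable_draw h.iIndepFun_draw hT hi
      (fun v q => Sum.elim (fun z => inner ℝ v.1 (batchGrad M.loss (M.D i) z (v.2 i)
        - gradient (localObj M.loss (M.D i)) (v.2 i))) (fun _ => 0) q) (fun _ => 0)
      (fun v => (hzero v).le)
    simpa [draw] using this
  · have := hUX.integral_le_of_notMem h.measurable_draw h.iIndepFun_draw hT hi
      (fun v q => Sum.elim (fun z => -inner ℝ v.1 (batchGrad M.loss (M.D i) z (v.2 i)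
        - gradient (localObj M.loss (M.D i)) (v.2 i))) (fun _ => 0) q) (fun _ => 0)
      (fun v => by simpa [draw, integral_neg] using (hzero v).ge)
    simp only [draw, Sum.elim_inl, integral_neg, integral_zero] at this
    linarith

lemma integral_norm_noise_sq_le (h : M.Admissible μ p L σ) (k t : ℕ) (i : Fin n) :
    ∫ ω, ‖M.noise k t ω i‖ ^ 2 ∂μ ≤ σ ^ 2 / b := by
  have := (M.determinedBy_localState_X k t).integral_le_of_notMem h.measurable_draw
    h.iIndepFun_draw (M.finite_past _) (M.batch_notMem_past i k t)
    (fun v q => Sum.elim (fun z => ‖batchGrad M.loss (M.D i) z (v i)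
        - gradient (localObj M.loss (M.D i)) (v i)‖ ^ 2) (fun _ => 0) q) (fun _ => σ ^ 2 / b)
    (fun v => (h.variance i _ _ _).2)
  simpa [draw, noise_apply] using this

lemma integral_frobSq_noise_le (h : M.Admissible μ p L σ) (k t : ℕ) :
    ∫ ω, frobSq (M.noise k t ω) ∂μ ≤ n * (σ ^ 2 / b) := by
  simp only [frobSq]
  rw [integral_finsetSum _ fun i _ =>
    h.integrable ((M.determinedBy_noise k t).comp fun N => ‖N i‖ ^ 2)]
  refine (Finset.sum_le_sum fun i _ => h.integral_norm_noise_sq_le k t i).trans ?_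
  simp

/-- The noise of one round: over agents and over local updates it averages out. -/
lemma integral_norm_sum_colAvg_noise_sq_le (h : M.Admissible μ p L σ) (k : ℕ) :
    ∫ ω, ‖∑ t ∈ Finset.range (M.To + 1), colAvg (M.noise k t ω)‖ ^ 2 ∂μ
      ≤ (M.To + 1) * σ ^ 2 / (n * b) := by
  have hn : (0 : ℝ) < n := by exact_mod_cast h.agents_pos
  set s : Finset (ℕ × Fin n) := Finset.range (M.To + 1) ×ˢ Finset.univ
  have hint : ∀ r ∈ s, ∀ r' ∈ s,
      Integrable (fun ω => inner ℝ (M.noise k r.1 ω r.2) (M.noise k r'.1 ω r'.2)) μ := by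
    intro r hr r' hr'
    simp only [s, Finset.mem_product, Finset.mem_range, Finset.mem_univ, and_true] at hr hr'
    exact h.integrable (N := k * (M.To + 2) + M.To + 1)
      ((((M.determinedBy_noise k r.1).mono (M.past_mono (by omega))).prodMk
        ((M.determinedBy_noise k r'.1).mono (M.past_mono (by omega)))).comp
          fun q => inner ℝ (q.1 r.2) (q.2 r'.2))
  -- a noise vector is orthogonal to those of earlier evaluations and of other agents
  have hlt : ∀ (t t' : ℕ) (i i' : Fin n), t < t' →
      ∫ ω, inner ℝ (M.noise k t ω i) (M.noise k t' ω i') ∂μ = 0 := fun t t' i i' htt =>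
    h.integral_inner_noise_eq_zero (M.finite_past _) subset_rfl (M.batch_notMem_past i' k t')
      (((M.determinedBy_noise k t).comp fun N => N i).mono (M.past_mono (by omega)))
  have horth : ∀ r ∈ s, ∀ r' ∈ s, r ≠ r' →
      ∫ ω, inner ℝ (M.noise k r.1 ω r.2) (M.noise k r'.1 ω r'.2) ∂μ = 0 := by
    rintro ⟨t, i⟩ - ⟨t', i'⟩ - hne
    rcases lt_trichotomy t t' with htt | rfl | htt
    · exact hlt t t' i i' htt
    · have hii : i' ≠ i := fun e => hne (by rw [e])
      refine h.integral_inner_noise_eq_zero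
        (T := insert (.inl (i, batchIdx k t)) (M.past (k * (M.To + 2) + t)))
        ((M.finite_past _).insert _) (Set.subset_insert _ _) ?_ ?_
      · rw [Set.mem_insert_iff, not_or]
        exact ⟨fun e => hii (congrArg Prod.fst (Sum.inl.inj e)), M.batch_notMem_past i' k t⟩
      · intro ω ω' e
        have e1 : (M.localState k t ω).X = (M.localState k t ω').X :=
          M.determinedBy_localState_X k t ω ω' fun j hj => e j (Set.mem_insert_of_mem _ hj)
        have e2 := e _ (Set.mem_insert _ _)
        simp only [draw, Sum.inl.injEq] at e2
        simp only [noise, localState_G, Pi.sub_apply, stochGrad, gradStack, e1, e2]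
    · simpa only [real_inner_comm] using hlt t' t i' i htt
  have hsum : ∀ ω, ‖∑ t ∈ Finset.range (M.To + 1), colAvg (M.noise k t ω)‖ ^ 2
      = (1 / (n : ℝ)) ^ 2 * ‖∑ r ∈ s, M.noise k r.1 ω r.2‖ ^ 2 := by
    intro ω
    rw [Finset.sum_product]
    simp only [colAvg, ← Finset.smul_sum]
    rw [norm_smul, mul_pow, Real.norm_eq_abs, sq_abs]
  simp only [hsum]
  rw [integral_const_mul, integral_norm_sum_sq_of_orthogonal s _ hint horth]
  have h1 : ∑ r ∈ s, ∫ ω, ‖M.noise k r.1 ω r.2‖ ^ 2 ∂μ ≤ (M.To + 1) * n * (σ ^ 2 / b) := by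
    refine (Finset.sum_le_sum fun r _ => h.integral_norm_noise_sq_le k r.1 r.2).trans ?_
    simp [s]
  calc (1 / (n : ℝ)) ^ 2 * ∑ r ∈ s, ∫ ω, ‖M.noise k r.1 ω r.2‖ ^ 2 ∂μ
      ≤ (1 / (n : ℝ)) ^ 2 * ((M.To + 1) * n * (σ ^ 2 / b)) := by gcongr
    _ = (M.To + 1) * σ ^ 2 / (n * b) := by field_simp

/-- One random mixing step contracts the expected squared deviation by `1 - λ_p`. -/
lemma integral_frobSq_dev_mix_le (h : M.Admissible μ p L σ) (k : ℕ) {V : Ω → Stack n d}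
    (hV : DeterminedBy M.draw (M.past (k * (M.To + 2) + (M.To + 1))) V) :
    ∫ ω, frobSq (dev (mix (V ω) (commMatrix M.W (M.c k ω)))) ∂μ
      ≤ (1 - expectedMixingRate p M.W) * ∫ ω, frobSq (dev (V ω)) ∂μ := by
  have hk : (.inr k : (Fin n × ℕ × ℕ) ⊕ ℕ) ∉ M.past (k * (M.To + 2) + (M.To + 1)) := by
    simp [past, time]
  have hmeas : MeasurableSet {ω | M.c k ω = true} :=
    h.draws.measurable_coin k (MeasurableSet.of_discrete (s := {true}))
  have hcoin : ∫ ω, (if M.c k ω then 0 else 1 - mixingRate M.W) ∂μ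
      = 1 - expectedMixingRate p M.W := by
    have e1 : ∀ ω, (if M.c k ω then 0 else 1 - mixingRate M.W)
        = (1 - mixingRate M.W)
          - (1 - mixingRate M.W) * {ω | M.c k ω = true}.indicator (fun _ => (1 : ℝ)) ω := by
      intro ω
      by_cases hc : M.c k ω = true <;> simp [hc]
    simp only [e1]
    rw [integral_sub (integrable_const _)
        (((integrable_const (1 : ℝ)).indicator hmeas).const_mul _),
      integral_const_mul, integral_indicator_const _ hmeas, h.draws.coin_prob k,
      one_sub_expectedMixingRate]
    simp
    ring
  have hc : ∀ f : Bool → ℝ, Integrable (fun ω => f (M.c k ω)) μ := fun f =>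
    (Integrable.of_finite (μ := μ.map (M.c k))).comp_measurable (h.draws.measurable_coin k)
  have key := hV.integral_le_of_notMem h.measurable_draw h.iIndepFun_draw (M.finite_past _) hk
    (fun v q => Sum.elim (fun _ => 0) (fun q => frobSq (dev (mix v (commMatrix M.W q)))) q)
    (fun v => (1 - expectedMixingRate p M.W) * frobSq (dev v)) (fun v => by
      simp only [draw, Sum.elim_inr]
      rw [← hcoin, ← integral_mul_const]
      exact integral_mono (hc fun q => frobSq (dev (mix v (commMatrix M.W q))))
        ((hc fun q => if q then 0 else 1 - mixingRate M.W).mul_const _)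
        fun ω => frobSq_dev_mix_commMatrix_le h.agents_pos h.doublyStochastic (M.c k ω) v)
  simpa only [draw, Sum.elim_inr, integral_const_mul] using key

end Admissible

end Model

/-! ### One-round estimates in expectation -/

namespace Model

section Paths

variable {n d m b : ℕ} {S Ω : Type*} (M : Model n d m b S Ω)

lemma determinedBy_localState_round {k t : ℕ} (ht : t ∈ Finset.range (M.To + 1)) :
    DeterminedBy M.draw (M.past ((k + 1) * (M.To + 2) + 1)) (M.localState k t) := by
  have hk : (k + 1) * (M.To + 2) = k * (M.To + 2) + (M.To + 2) := by ring
  rw [Finset.mem_range] at ht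
  exact (M.determinedBy_localState k t).mono (M.past_mono (by omega))

lemma determinedBy_state_round (k : ℕ) :
    DeterminedBy M.draw (M.past ((k + 1) * (M.To + 2) + 1)) (M.state k) :=
  M.determinedBy_localState_round (t := 0) (by simp)

lemma determinedBy_noise_round {k t : ℕ} (ht : t ∈ Finset.range (M.To + 1)) :
    DeterminedBy M.draw (M.past ((k + 1) * (M.To + 2) + 1)) (M.noise k t) :=
  (M.determinedBy_localState_round ht).comp fun s => s.G - gradStack M.loss M.D s.X

lemma determinedBy_coin_round (k : ℕ) :
    DeterminedBy M.draw (M.past ((k + 1) * (M.To + 2) + 1)) (M.c k) := fun ω ω' e =>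
  M.c_eq_of_draw_eq (k := k)
    (by have hk : (k + 1) * (M.To + 2) = k * (M.To + 2) + (M.To + 2) := by ring
        omega) e

lemma localState_G_eq (k t : ℕ) (ω : Ω) :
    (M.localState k t ω).G = gradStack M.loss M.D (M.localState k t ω).X + M.noise k t ω := by
  rw [noise]; abel

lemma determinedBy_mixed (k : ℕ) (a : ℝ) :
    DeterminedBy M.draw (M.past (k * (M.To + 2) + (M.To + 1))) (fun ω =>
      (M.state k ω).X - a • ∑ r ∈ Finset.range (M.To + 1), (M.localState k r ω).Y) := by
  intro ω ω' e
  have e1 : ∀ r ∈ Finset.range (M.To + 1), M.localState k r ω = M.localState k r ω' := by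
    intro r hr
    rw [Finset.mem_range] at hr
    exact M.determinedBy_localState k r ω ω' fun i hi => e i (M.past_mono (by omega) hi)
  have e0 : M.state k ω = M.state k ω' := e1 0 (by simp)
  beta_reduce
  rw [e0, Finset.sum_congr rfl fun r hr => congrArg State.Y (e1 r hr)]

variable {M}

lemma frobSq_localState_X_sub_le {k t : ℕ} (ht : t ≤ M.To) (ω : Ω) :
    frobSq ((M.localState k t ω).X - (M.state k ω).X)
      ≤ M.ηl ^ 2 * M.To * ∑ r ∈ Finset.range (M.To + 1), frobSq (M.localState k r ω).Y := by
  have h1 : (M.localState k t ω).X - (M.state k ω).X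
      = -(M.ηl • ∑ r ∈ Finset.range t, (M.localState k r ω).Y) := by
    rw [localState_X]; abel
  rw [h1, frobSq_neg, frobSq_smul, mul_assoc]
  refine mul_le_mul_of_nonneg_left ?_ (sq_nonneg _)
  refine (frobSq_sum_le _ _).trans ?_
  rw [Finset.card_range]
  have h2 : ∑ r ∈ Finset.range t, frobSq (M.localState k r ω).Y
      ≤ ∑ r ∈ Finset.range (M.To + 1), frobSq (M.localState k r ω).Y :=
    Finset.sum_le_sum_of_subset_of_nonneg (Finset.range_mono (by omega))
      fun _ _ _ => frobSq_nonneg _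
  have h3 : (t : ℝ) ≤ M.To := by exact_mod_cast ht
  have h4 : 0 ≤ ∑ r ∈ Finset.range t, frobSq (M.localState k r ω).Y :=
    Finset.sum_nonneg fun _ _ => frobSq_nonneg _
  exact mul_le_mul h3 h2 h4 (Nat.cast_nonneg _)

lemma frobSq_smul_sum_Y_le (a : ℝ) (k : ℕ) (ω : Ω) :
    frobSq (a • ∑ r ∈ Finset.range (M.To + 1), (M.localState k r ω).Y)
      ≤ a ^ 2 * (M.To + 1) * ∑ r ∈ Finset.range (M.To + 1), frobSq (M.localState k r ω).Y := by
  rw [frobSq_smul, mul_assoc]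
  refine mul_le_mul_of_nonneg_left ?_ (sq_nonneg _)
  simpa using frobSq_sum_le (Finset.range (M.To + 1)) fun r => (M.localState k r ω).Y

end Paths

variable {n d m b : ℕ} {S Ω : Type*} [MeasurableSpace Ω]

section Quantities

variable (M : Model n d m b S Ω) (μ : Measure Ω) (k : ℕ)

/-- The gradient tracking error `E ‖Y^k - Y^k J‖²`. -/
noncomputable def trackErr : ℝ := ∫ ω, frobSq (dev (M.state k ω).Y) ∂μ

/-- The consensus error `E ‖X^k - X^k J‖²`. -/
noncomputable def consErr : ℝ := ∫ ω, frobSq (dev (M.state k ω).X) ∂μ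

/-- The total squared size of the search directions of round `k`. -/
noncomputable def dirSq : ℝ :=
  ∑ t ∈ Finset.range (M.To + 1), ∫ ω, frobSq (M.localState k t ω).Y ∂μ

/-- The client drift of round `k`: the squared distances of the local points from `X^k`. -/
noncomputable def drift : ℝ :=
  ∑ t ∈ Finset.range (M.To + 1), ∫ ω, frobSq ((M.localState k t ω).X - (M.state k ω).X) ∂μ

/-- The squared averages of the true local gradients at the local points of round `k`. -/
noncomputable def avgGradSq : ℝ :=
  ∑ t ∈ Finset.range (M.To + 1),
    ∫ ω, ‖colAvg (gradStack M.loss M.D (M.localState k t ω).X)‖ ^ 2 ∂μ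

/-- The squared gradient `E ‖∇f(x̄^k)‖²`. -/
noncomputable def gradSq : ℝ :=
  ∫ ω, ‖gradient (globalObj M.loss M.D) (colAvg (M.state k ω).X)‖ ^ 2 ∂μ

/-- The objective value `E f(x̄^k)`. -/
noncomputable def expObj : ℝ := ∫ ω, globalObj M.loss M.D (colAvg (M.state k ω).X) ∂μ

end Quantities

section Pathwise

variable {M : Model n d m b S Ω} {μ : Measure Ω} {p L σ : ℝ} (h : M.Admissible μ p L σ)
include h

lemma Admissible.rate_le_one : expectedMixingRate p M.W ≤ 1 := by
  have h1 := one_sub_expectedMixingRate p M.W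
  have h2 := mixingRate_le_one M.W
  have h3 := mul_nonneg (sub_nonneg.2 h.prob_le_one) (sub_nonneg.2 h2)
  linarith

lemma Admissible.one_sub_rate_le : 1 - expectedMixingRate p M.W ≤ 1 - p := by
  rw [one_sub_expectedMixingRate]
  have h2 := mixingRate_nonneg h.agents_pos h.doublyStochastic
  have h3 := mul_nonneg (sub_nonneg.2 h.prob_le_one) h2
  linarith

lemma Admissible.row_sum (k : ℕ) (ω : Ω) (i : Fin n) :
    ∑ j, commMatrix M.W (M.c k ω) i j = 1 :=
  (mem_doublyStochastic_iff_sum.1 (commMatrix_mem_doublyStochastic h.agents_pos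
    h.doublyStochastic (M.c k ω))).2.1 i

lemma Admissible.col_sum (k : ℕ) (ω : Ω) (j : Fin n) :
    ∑ i, commMatrix M.W (M.c k ω) i j = 1 :=
  (mem_doublyStochastic_iff_sum.1 (commMatrix_mem_doublyStochastic h.agents_pos
    h.doublyStochastic (M.c k ω))).2.2 j

lemma Admissible.colAvg_localState_Y (k t : ℕ) (ω : Ω) :
    colAvg (M.localState k t ω).Y = colAvg (M.localState k t ω).G := by
  have h1 : colAvg (M.state k ω).Y = colAvg (M.state k ω).G :=
    colAvg_run_Y (fun k i => h.row_sum k ω i) k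
  rw [localState_Y, colAvg_add, colAvg_sub, h1, sub_self, zero_add]

lemma Admissible.frobSq_localState_Y_le (k t : ℕ) (ω : Ω) :
    frobSq (M.localState k t ω).Y ≤ 4 * frobSq (dev (M.state k ω).Y)
      + 4 * L ^ 2 * frobSq ((M.localState k t ω).X - (M.state k ω).X)
      + 6 * frobSq (M.noise k t ω) + 4 * frobSq (M.noise k 0 ω)
      + 2 * n * ‖colAvg (gradStack M.loss M.D (M.localState k t ω).X)‖ ^ 2 := by
  have hn := h.agents_pos
  rw [frobSq_eq_dev_add_colAvg hn, h.colAvg_localState_Y, localState_G_eq, colAvg_add]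
  have h1 : dev (M.localState k t ω).Y = dev (M.state k ω).Y
      + dev (gradStack M.loss M.D (M.localState k t ω).X - gradStack M.loss M.D (M.state k ω).X)
      + dev (M.noise k t ω) + dev (-M.noise k 0 ω) := by
    rw [← dev_add, ← dev_add, ← dev_add, localState_Y, noise, noise, localState_zero]
    congr 1; abel
  have h2 := frobSq_add_le_four (dev (M.state k ω).Y)
    (dev (gradStack M.loss M.D (M.localState k t ω).X - gradStack M.loss M.D (M.state k ω).X))
    (dev (M.noise k t ω)) (dev (-M.noise k 0 ω))
  have h3 := (frobSq_dev_le hn _).trans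
    (h.smooth.frobSq_gradStack_sub_le (M.localState k t ω).X (M.state k ω).X)
  have h4 := frobSq_dev_le hn (M.noise k t ω)
  have h5 := frobSq_dev_le hn (-M.noise k 0 ω)
  rw [frobSq_neg] at h5
  have h6 := norm_add_sq_le_two (colAvg (gradStack M.loss M.D (M.localState k t ω).X))
    (colAvg (M.noise k t ω))
  have h7 := norm_colAvg_sq_le hn (M.noise k t ω)
  have h8 := mul_le_mul_of_nonneg_left h6 (Nat.cast_nonneg (α := ℝ) n)
  rw [h1]
  linarith

lemma Admissible.frobSq_state_X_sub_le (k : ℕ) (ω : Ω) :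
    frobSq ((M.state (k + 1) ω).X - (M.state k ω).X) ≤ 8 * frobSq (dev (M.state k ω).X)
      + 2 * (M.ηc * M.ηl) ^ 2 * (M.To + 1)
        * ∑ r ∈ Finset.range (M.To + 1), frobSq (M.localState k r ω).Y := by
  have hM := commMatrix_mem_doublyStochastic h.agents_pos h.doublyStochastic (M.c k ω)
  set N := commMatrix M.W (M.c k ω)
  set Y := (M.ηc * M.ηl) • ∑ r ∈ Finset.range (M.To + 1), (M.localState k r ω).Y
  have hX : (M.state k ω).X = dev (M.state k ω).X + fun _ => colAvg (M.state k ω).X := by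
    ext1 i; simp [dev]
  have h1 : (M.state (k + 1) ω).X - (M.state k ω).X
      = (mix (dev (M.state k ω).X) N - dev (M.state k ω).X) - mix Y N := by
    have h2 : mix (M.state k ω).X N
        = mix (dev (M.state k ω).X) N + fun _ => colAvg (M.state k ω).X := by
      conv_lhs => rw [hX]
      rw [mix_add, mix_const (h.col_sum k ω)]
    rw [state_succ_X, mix_sub, h2]
    nth_rewrite 3 [hX]
    abel
  rw [h1]
  have h3 := frobSq_sub_le_two (mix (dev (M.state k ω).X) N - dev (M.state k ω).X) (mix Y N)
  have h4 := frobSq_sub_le_two (mix (dev (M.state k ω).X) N) (dev (M.state k ω).X)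
  have h5 := frobSq_mix_le hM (dev (M.state k ω).X)
  have h6 := frobSq_mix_le hM Y
  have h7 : frobSq Y ≤ _ := frobSq_smul_sum_Y_le (M.ηc * M.ηl) k ω
  linarith

lemma Admissible.frobSq_state_G_sub_le (k : ℕ) (ω : Ω) :
    frobSq ((M.state (k + 1) ω).G - (M.state k ω).G)
      ≤ 3 * L ^ 2 * frobSq ((M.state (k + 1) ω).X - (M.state k ω).X)
        + 3 * frobSq (M.noise (k + 1) 0 ω) + 3 * frobSq (M.noise k 0 ω) := by
  have h1 : (M.state (k + 1) ω).G - (M.state k ω).G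
      = (gradStack M.loss M.D (M.state (k + 1) ω).X - gradStack M.loss M.D (M.state k ω).X)
        + M.noise (k + 1) 0 ω + -M.noise k 0 ω := by
    simp only [noise, localState_zero]; abel
  rw [h1]
  have h2 := frobSq_add_le_three
    (gradStack M.loss M.D (M.state (k + 1) ω).X - gradStack M.loss M.D (M.state k ω).X)
    (M.noise (k + 1) 0 ω) (-M.noise k 0 ω)
  rw [frobSq_neg] at h2
  have h3 := h.smooth.frobSq_gradStack_sub_le (M.state (k + 1) ω).X (M.state k ω).X
  linarith

lemma Admissible.colAvg_state_succ_X (k : ℕ) (ω : Ω) :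
    colAvg (M.state (k + 1) ω).X = colAvg (M.state k ω).X
      + -((M.ηc * M.ηl) • (∑ t ∈ Finset.range (M.To + 1),
          colAvg (gradStack M.loss M.D (M.localState k t ω).X)
        + ∑ t ∈ Finset.range (M.To + 1), colAvg (M.noise k t ω))) := by
  rw [state_succ_X, colAvg_mix (h.row_sum k ω), colAvg_sub, colAvg_smul, colAvg_sum,
    ← Finset.sum_add_distrib, sub_eq_add_neg]
  congr 3
  refine Finset.sum_congr rfl fun t _ => ?_
  rw [h.colAvg_localState_Y, localState_G_eq, colAvg_add]

/-- The descent step along one path. The cross terms with the noise have zero expectation. -/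
lemma Admissible.globalObj_state_succ_le (hη : 0 ≤ M.ηc * M.ηl) (k : ℕ) (ω : Ω) :
    globalObj M.loss M.D (colAvg (M.state (k + 1) ω).X)
      ≤ globalObj M.loss M.D (colAvg (M.state k ω).X)
        - (M.ηc * M.ηl) * (M.To + 1) / 2
          * ‖gradient (globalObj M.loss M.D) (colAvg (M.state k ω).X)‖ ^ 2
        - (M.ηc * M.ηl) * (1 / 2 - L * (M.ηc * M.ηl) * (M.To + 1))
          * ∑ t ∈ Finset.range (M.To + 1),
            ‖colAvg (gradStack M.loss M.D (M.localState k t ω).X)‖ ^ 2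
        + (M.ηc * M.ηl) * L ^ 2 / n * ∑ t ∈ Finset.range (M.To + 1),
            frobSq ((M.localState k t ω).X - (M.state k ω).X)
        + (M.ηc * M.ηl) * L ^ 2 / n * (M.To + 1) * frobSq (dev (M.state k ω).X)
        + L * (M.ηc * M.ηl) ^ 2 * ‖∑ t ∈ Finset.range (M.To + 1), colAvg (M.noise k t ω)‖ ^ 2
        - (M.ηc * M.ηl) * ∑ t ∈ Finset.range (M.To + 1),
            inner ℝ (gradient (globalObj M.loss M.D) (colAvg (M.state k ω).X))
              (colAvg (M.noise k t ω)) := by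
  have hn : (0 : ℝ) < n := by exact_mod_cast h.agents_pos
  have hL := h.smoothness_pos
  rw [h.colAvg_state_succ_X]
  set η := M.ηc * M.ηl
  set x := colAvg (M.state k ω).X
  set v := gradient (globalObj M.loss M.D) x with hv
  set P : ℕ → Vec d := fun t => colAvg (gradStack M.loss M.D (M.localState k t ω).X) with hP
  set e : ℕ → Vec d := fun t => colAvg (M.noise k t ω)
  set s := Finset.range (M.To + 1)
  have h1 := le_add_inner_gradient_of_lipschitz h.smooth.differentiable_globalObj
    (h.smooth.lipschitz_gradient_globalObj h.agents_pos hL.le) x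
    (-(η • (∑ t ∈ s, P t + ∑ t ∈ s, e t)))
  rw [← hv, norm_neg, norm_smul, mul_pow, Real.norm_eq_abs, sq_abs, inner_neg_right,
    inner_smul_right, inner_add_right, inner_sum, inner_sum] at h1
  have h2 := norm_add_sq_le_two (∑ t ∈ s, P t) (∑ t ∈ s, e t)
  have h3 : ‖∑ t ∈ s, P t‖ ^ 2 ≤ (M.To + 1) * ∑ t ∈ s, ‖P t‖ ^ 2 := by
    simpa [s] using norm_sum_sq_le s P
  have h4 : ∀ t, -inner ℝ v (P t) ≤ L ^ 2 / n * frobSq ((M.localState k t ω).X - (M.state k ω).X)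
      + L ^ 2 / n * frobSq (dev (M.state k ω).X) - ‖v‖ ^ 2 / 2 - ‖P t‖ ^ 2 / 2 := by
    intro t
    have h5 := h.smooth.norm_gradient_sub_colAvg_sq_le h.agents_pos (M.state k ω).X
      (M.localState k t ω).X
    have h6 : ‖v - P t‖ ^ 2 ≤ 2 * L ^ 2 * (frobSq (dev (M.state k ω).X)
        + frobSq ((M.localState k t ω).X - (M.state k ω).X)) / n := by
      rw [le_div_iff₀ hn, mul_comm]; exact h5
    rw [norm_sub_sq_real] at h6
    have h7 : 2 * L ^ 2 * (frobSq (dev (M.state k ω).X)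
        + frobSq ((M.localState k t ω).X - (M.state k ω).X)) / n
        = 2 * (L ^ 2 / n * frobSq ((M.localState k t ω).X - (M.state k ω).X)
          + L ^ 2 / n * frobSq (dev (M.state k ω).X)) := by ring
    rw [h7] at h6
    linarith
  have h5 : -∑ t ∈ s, inner ℝ v (P t)
      ≤ L ^ 2 / n * ∑ t ∈ s, frobSq ((M.localState k t ω).X - (M.state k ω).X)
        + (M.To + 1) * (L ^ 2 / n * frobSq (dev (M.state k ω).X)) - (M.To + 1) * (‖v‖ ^ 2 / 2)
        - (∑ t ∈ s, ‖P t‖ ^ 2) / 2 := by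
    rw [← Finset.sum_neg_distrib]
    refine (Finset.sum_le_sum fun t _ => h4 t).trans (le_of_eq ?_)
    simp only [Finset.sum_add_distrib, Finset.sum_sub_distrib, ← Finset.mul_sum,
      ← Finset.sum_div, Finset.sum_const, s, Finset.card_range, nsmul_eq_mul]
    push_cast
    ring
  have h6 := mul_le_mul_of_nonneg_left h5 hη
  have h7 : L / 2 * (η ^ 2 * ‖∑ t ∈ s, P t + ∑ t ∈ s, e t‖ ^ 2)
      ≤ L / 2 * (η ^ 2 * (2 * ((M.To + 1) * ∑ t ∈ s, ‖P t‖ ^ 2) + 2 * ‖∑ t ∈ s, e t‖ ^ 2)) := by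
    have : 0 ≤ η ^ 2 := sq_nonneg η
    gcongr
    linarith
  have h8 : η * (L ^ 2 / n * ∑ t ∈ s, frobSq ((M.localState k t ω).X - (M.state k ω).X)
        + (M.To + 1) * (L ^ 2 / n * frobSq (dev (M.state k ω).X)) - (M.To + 1) * (‖v‖ ^ 2 / 2)
        - (∑ t ∈ s, ‖P t‖ ^ 2) / 2)
      = η * L ^ 2 / n * ∑ t ∈ s, frobSq ((M.localState k t ω).X - (M.state k ω).X)
        + η * L ^ 2 / n * (M.To + 1) * frobSq (dev (M.state k ω).X)
        - η * (M.To + 1) / 2 * ‖v‖ ^ 2 - η / 2 * ∑ t ∈ s, ‖P t‖ ^ 2 := by ring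
  rw [h8] at h6
  linarith

end Pathwise

end Model

/-- The factor that Young's inequality leaves when a contraction gives up half of its rate. -/
lemma one_add_one_div_half_le {lam : ℝ} (hlam : 0 < lam) (hlam1 : lam ≤ 1) :
    1 + 1 / (lam / 2) ≤ 3 / lam := by
  rw [← sub_nonneg]
  have : 3 / lam - (1 + 1 / (lam / 2)) = (1 - lam) / lam := by field_simp; ring
  rw [this]
  exact div_nonneg (by linarith) hlam.le

namespace Model

namespace Admissible

variable {n d m b : ℕ} {S Ω : Type*} [MeasurableSpace Ω] {M : Model n d m b S Ω} {μ : Measure Ω}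
  [IsProbabilityMeasure μ] {p L σ : ℝ} (h : M.Admissible μ p L σ)
include h

lemma integrable_Y {k t : ℕ} (ht : t ∈ Finset.range (M.To + 1)) :
    Integrable (fun ω => frobSq (M.localState k t ω).Y) μ :=
  h.integrable ((M.determinedBy_localState_round ht).comp fun s => frobSq s.Y)

lemma integrable_drift {k t : ℕ} (ht : t ∈ Finset.range (M.To + 1)) :
    Integrable (fun ω => frobSq ((M.localState k t ω).X - (M.state k ω).X)) μ :=
  h.integrable (((M.determinedBy_localState_round ht).prodMk (M.determinedBy_state_round k)).comp
    fun s => frobSq (s.1.X - s.2.X))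

lemma integrable_noise (k t : ℕ) : Integrable (fun ω => frobSq (M.noise k t ω)) μ :=
  h.integrable ((M.determinedBy_noise k t).comp frobSq)

lemma integrable_avgGrad {k t : ℕ} (ht : t ∈ Finset.range (M.To + 1)) :
    Integrable (fun ω => ‖colAvg (gradStack M.loss M.D (M.localState k t ω).X)‖ ^ 2) μ :=
  h.integrable ((M.determinedBy_localState_round ht).comp fun s =>
    ‖colAvg (gradStack M.loss M.D s.X)‖ ^ 2)

lemma integrable_state {E : Type*} [NormedAddCommGroup E] (k : ℕ) (f : State n d → E) :
    Integrable (fun ω => f (M.state k ω)) μ :=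
  h.integrable ((M.determinedBy_state k).comp f)

lemma integral_sum_Y (k : ℕ) :
    ∫ ω, ∑ t ∈ Finset.range (M.To + 1), frobSq (M.localState k t ω).Y ∂μ = M.dirSq μ k :=
  integral_finsetSum _ fun _ ht => h.integrable_Y ht

lemma integrable_sum_Y (k : ℕ) :
    Integrable (fun ω => ∑ t ∈ Finset.range (M.To + 1), frobSq (M.localState k t ω).Y) μ :=
  integrable_finsetSum _ fun _ ht => h.integrable_Y ht

lemma dirSq_le (k : ℕ) :
    M.dirSq μ k ≤ 4 * (M.To + 1) * M.trackErr μ k + 4 * L ^ 2 * M.drift μ k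
      + 10 * (M.To + 1) * (n * (σ ^ 2 / b)) + 2 * n * M.avgGradSq μ k := by
  have key : ∀ t ∈ Finset.range (M.To + 1), ∫ ω, frobSq (M.localState k t ω).Y ∂μ
      ≤ 4 * M.trackErr μ k
        + 4 * L ^ 2 * ∫ ω, frobSq ((M.localState k t ω).X - (M.state k ω).X) ∂μ
        + 10 * (n * (σ ^ 2 / b))
        + 2 * n * ∫ ω, ‖colAvg (gradStack M.loss M.D (M.localState k t ω).X)‖ ^ 2 ∂μ := by
    intro t ht
    have h1 := integral_le_sum_mul_integral (μ := μ) ![4, 4 * L ^ 2, 6, 4, 2 * n]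
      ![fun ω => frobSq (dev (M.state k ω).Y),
        fun ω => frobSq ((M.localState k t ω).X - (M.state k ω).X),
        fun ω => frobSq (M.noise k t ω), fun ω => frobSq (M.noise k 0 ω),
        fun ω => ‖colAvg (gradStack M.loss M.D (M.localState k t ω).X)‖ ^ 2]
      (h.integrable_Y ht)
      (by
        intro i
        fin_cases i
        · exact h.integrable_state k fun s => frobSq (dev s.Y)
        · exact h.integrable_drift ht
        · exact h.integrable_noise k t
        · exact h.integrable_noise k 0
        · exact h.integrable_avgGrad ht)
      (fun ω => by
        simpa [Fin.sum_univ_five] using h.frobSq_localState_Y_le k t ω)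
    simp [Fin.sum_univ_five] at h1
    have h2 := h.integral_frobSq_noise_le k t
    have h3 := h.integral_frobSq_noise_le k 0
    unfold trackErr
    linarith
  refine (Finset.sum_le_sum key).trans (le_of_eq ?_)
  simp only [Finset.sum_add_distrib, ← Finset.mul_sum, Finset.sum_const, Finset.card_range,
    nsmul_eq_mul, drift, avgGradSq]
  push_cast
  ring

lemma drift_le (k : ℕ) : M.drift μ k ≤ M.ηl ^ 2 * M.To ^ 2 * M.dirSq μ k := by
  have key : ∀ t ∈ Finset.range (M.To + 1),
      ∫ ω, frobSq ((M.localState k t ω).X - (M.state k ω).X) ∂μ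
        ≤ M.ηl ^ 2 * M.To * M.dirSq μ k := by
    intro t ht
    rw [← h.integral_sum_Y, ← integral_const_mul]
    exact integral_mono (h.integrable_drift ht) ((h.integrable_sum_Y k).const_mul _) fun ω =>
      frobSq_localState_X_sub_le (by simpa [Nat.lt_succ_iff] using ht) ω
  -- the local point with `t = 0` is `X^k` itself, so only `T_o` terms count
  rw [drift, Finset.sum_range_succ']
  simp only [localState_zero, sub_self, frobSq_zero, integral_zero, add_zero]
  calc ∑ t ∈ Finset.range M.To,
        ∫ ω, frobSq ((M.localState k (t + 1) ω).X - (M.state k ω).X) ∂μ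
      ≤ ∑ t ∈ Finset.range M.To, M.ηl ^ 2 * M.To * M.dirSq μ k :=
        Finset.sum_le_sum fun t ht => key (t + 1) (by simpa using ht)
    _ = _ := by
        rw [Finset.sum_const, Finset.card_range, nsmul_eq_mul]; ring

lemma consErr_succ_le (k : ℕ) :
    M.consErr μ (k + 1) ≤ (1 - expectedMixingRate p M.W / 2) * M.consErr μ k
      + (1 - p) * (3 / expectedMixingRate p M.W) * (M.ηc * M.ηl) ^ 2 * (M.To + 1)
        * M.dirSq μ k := by
  have hlam := h.rate_pos
  have hlam1 := h.rate_le_one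
  have hlamp := h.one_sub_rate_le
  set lam := expectedMixingRate p M.W
  have h1 := h.integral_frobSq_dev_mix_le k (M.determinedBy_mixed k (M.ηc * M.ηl))
  simp only [← state_succ_X] at h1
  have h2 := integral_le_sum_mul_integral (μ := μ)
    ![1 + lam / 2, (1 + 1 / (lam / 2)) * ((M.ηc * M.ηl) ^ 2 * (M.To + 1))]
    ![fun ω => frobSq (dev (M.state k ω).X),
      fun ω => ∑ r ∈ Finset.range (M.To + 1), frobSq (M.localState k r ω).Y]
    (h.integrable ((M.determinedBy_mixed k (M.ηc * M.ηl)).comp fun V => frobSq (dev V)))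
    (by
      intro i
      fin_cases i
      · exact h.integrable_state k fun s => frobSq (dev s.X)
      · exact h.integrable_sum_Y k)
    (fun ω => by
      simp only [Fin.sum_univ_two, Matrix.cons_val_zero, Matrix.cons_val_one]
      rw [dev_sub, sub_eq_add_neg]
      refine (frobSq_add_le_young _ _ (half_pos hlam)).trans ?_
      rw [frobSq_neg, mul_assoc (1 + 1 / (lam / 2))]
      gcongr
      exact (frobSq_dev_le h.agents_pos _).trans (frobSq_smul_sum_Y_le _ k ω))
  simp only [Fin.sum_univ_two, Matrix.cons_val_zero, Matrix.cons_val_one, h.integral_sum_Y] at h2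
  have hc : 0 ≤ ∫ ω, frobSq (dev (M.state k ω).X) ∂μ :=
    integral_nonneg fun ω => frobSq_nonneg _
  have hS : 0 ≤ (M.ηc * M.ηl) ^ 2 * (M.To + 1) * M.dirSq μ k := by
    rw [← h.integral_sum_Y]
    have : 0 ≤ ∫ ω, ∑ r ∈ Finset.range (M.To + 1), frobSq (M.localState k r ω).Y ∂μ :=
      integral_nonneg fun ω => Finset.sum_nonneg fun _ _ => frobSq_nonneg _
    positivity
  have h3 : (1 - lam) * (1 + lam / 2) ≤ 1 - lam / 2 := by nlinarith
  have h4 : (1 - lam) * (1 + 1 / (lam / 2)) ≤ (1 - p) * (3 / lam) := by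
    have h5 := one_add_one_div_half_le hlam hlam1
    exact mul_le_mul hlamp h5 (by positivity) (by linarith)
  calc M.consErr μ (k + 1) ≤ (1 - lam) * _ := h1
    _ ≤ (1 - lam) * _ := mul_le_mul_of_nonneg_left h2 (by linarith)
    _ = (1 - lam) * (1 + lam / 2) * M.consErr μ k + (1 - lam) * (1 + 1 / (lam / 2))
          * ((M.ηc * M.ηl) ^ 2 * (M.To + 1) * M.dirSq μ k) := by rw [consErr]; ring
    _ ≤ (1 - lam / 2) * M.consErr μ k + (1 - p) * (3 / lam)
          * ((M.ηc * M.ηl) ^ 2 * (M.To + 1) * M.dirSq μ k) := by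
        rw [consErr]; gcongr
    _ = _ := by ring

lemma trackErr_succ_le (k : ℕ) :
    M.trackErr μ (k + 1) ≤ (1 - expectedMixingRate p M.W / 2) * M.trackErr μ k
      + 3 / expectedMixingRate p M.W * (3 * L ^ 2 * (8 * M.consErr μ k
        + 2 * (M.ηc * M.ηl) ^ 2 * (M.To + 1) * M.dirSq μ k) + 6 * (n * (σ ^ 2 / b))) := by
  have hlam := h.rate_pos
  have hlam1 := h.rate_le_one
  set lam := expectedMixingRate p M.W
  have hY : DeterminedBy M.draw (M.past (k * (M.To + 2) + (M.To + 1))) fun ω => (M.state k ω).Y :=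
    ((M.determinedBy_state k).mono (M.past_mono (by omega))).comp fun s => s.Y
  have h1 := h.integral_frobSq_dev_mix_le k hY
  have h2 := integral_le_sum_mul_integral (μ := μ)
    ![1 + lam / 2, 3 / lam * (3 * L ^ 2 * 8),
      3 / lam * (3 * L ^ 2 * (2 * (M.ηc * M.ηl) ^ 2 * (M.To + 1))), 3 / lam * 3, 3 / lam * 3]
    ![fun ω => frobSq (dev (mix (M.state k ω).Y (commMatrix M.W (M.c k ω)))),
      fun ω => frobSq (dev (M.state k ω).X),
      fun ω => ∑ r ∈ Finset.range (M.To + 1), frobSq (M.localState k r ω).Y,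
      fun ω => frobSq (M.noise (k + 1) 0 ω), fun ω => frobSq (M.noise k 0 ω)]
    (h.integrable_state (k + 1) fun s => frobSq (dev s.Y))
    (by
      intro i
      fin_cases i
      · exact h.integrable (((M.determinedBy_state_round k).prodMk
          (M.determinedBy_coin_round k)).comp
            fun q => frobSq (dev (mix q.1.Y (commMatrix M.W q.2))))
      · exact h.integrable_state k fun s => frobSq (dev s.X)
      · exact h.integrable_sum_Y k
      · exact h.integrable_noise (k + 1) 0
      · exact h.integrable_noise k 0)
    (fun ω => by
      simp [Fin.sum_univ_five]
      rw [state_succ_Y, mix_add, dev_add]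
      have e1 := frobSq_add_le_young (dev (mix (M.state k ω).Y (commMatrix M.W (M.c k ω))))
        (dev (mix ((M.state (k + 1) ω).G - (M.state k ω).G) (commMatrix M.W (M.c k ω))))
        (half_pos hlam)
      have e2 := (frobSq_dev_le h.agents_pos _).trans (frobSq_mix_le
        (commMatrix_mem_doublyStochastic h.agents_pos h.doublyStochastic (M.c k ω))
        ((M.state (k + 1) ω).G - (M.state k ω).G))
      have e3 := h.frobSq_state_G_sub_le k ω
      have e4 := mul_le_mul_of_nonneg_left (h.frobSq_state_X_sub_le k ω)
        (by positivity : 0 ≤ 3 * L ^ 2)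
      have e5 := one_add_one_div_half_le hlam hlam1
      have e6 := mul_le_mul e5 (e2.trans (e3.trans (by linarith [e4] : _ ≤
        3 * L ^ 2 * (8 * frobSq (dev (M.state k ω).X) + 2 * (M.ηc * M.ηl) ^ 2 * (M.To + 1)
        * ∑ r ∈ Finset.range (M.To + 1), frobSq (M.localState k r ω).Y)
        + 3 * frobSq (M.noise (k + 1) 0 ω) + 3 * frobSq (M.noise k 0 ω))))
        (frobSq_nonneg _) (by positivity)
      refine (e1.trans (add_le_add_right e6 _)).trans (le_of_eq ?_)
      ring)
  simp [Fin.sum_univ_five, h.integral_sum_Y] at h2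
  have h3 := h.integral_frobSq_noise_le (k + 1) 0
  have h4 := h.integral_frobSq_noise_le k 0
  have hy : 0 ≤ ∫ ω, frobSq (dev (M.state k ω).Y) ∂μ :=
    integral_nonneg fun ω => frobSq_nonneg _
  have h5 : (1 - lam) * (1 + lam / 2) ≤ 1 - lam / 2 := by nlinarith
  have h6 : (1 + lam / 2) * ∫ ω, frobSq (dev (mix (M.state k ω).Y (commMatrix M.W (M.c k ω)))) ∂μ
      ≤ (1 - lam / 2) * ∫ ω, frobSq (dev (M.state k ω).Y) ∂μ :=
    calc _ ≤ (1 + lam / 2) * ((1 - lam) * ∫ ω, frobSq (dev (M.state k ω).Y) ∂μ) := by gcongr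
      _ = (1 - lam) * (1 + lam / 2) * ∫ ω, frobSq (dev (M.state k ω).Y) ∂μ := by ring
      _ ≤ _ := by gcongr
  have h7 : 3 / lam * 3 * ∫ ω, frobSq (M.noise (k + 1) 0 ω) ∂μ
      ≤ 3 / lam * 3 * (n * (σ ^ 2 / b)) := by gcongr
  have h8 : 3 / lam * 3 * ∫ ω, frobSq (M.noise k 0 ω) ∂μ
      ≤ 3 / lam * 3 * (n * (σ ^ 2 / b)) := by gcongr
  unfold trackErr consErr
  linarith

lemma integral_inner_gradient_noise (k t : ℕ) :
    ∫ ω, inner ℝ (gradient (globalObj M.loss M.D) (colAvg (M.state k ω).X))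
      (colAvg (M.noise k t ω)) ∂μ = 0 := by
  have hU : DeterminedBy M.draw (M.past (k * (M.To + 2) + t))
      fun ω => gradient (globalObj M.loss M.D) (colAvg (M.state k ω).X) :=
    ((M.determinedBy_localState_X k 0).mono (M.past_mono (by omega))).comp
      fun X => gradient (globalObj M.loss M.D) (colAvg X)
  simp only [colAvg, inner_smul_right, inner_sum] at hU ⊢
  rw [integral_const_mul, integral_finsetSum, Finset.sum_eq_zero, mul_zero]
  · exact fun i _ => h.integral_inner_noise_eq_zero (M.finite_past _) subset_rfl
      (M.batch_notMem_past i k t) hU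
  · exact fun i _ => h.integrable (((hU.mono (M.past_mono (Nat.le_succ _))).prodMk
      (M.determinedBy_noise k t)).comp fun q => inner ℝ q.1 (q.2 i))

lemma expObj_succ_le (hη : 0 ≤ M.ηc * M.ηl) (k : ℕ) :
    M.expObj μ (k + 1) ≤ M.expObj μ k
      - (M.ηc * M.ηl) * (M.To + 1) / 2 * M.gradSq μ k
      - (M.ηc * M.ηl) * (1 / 2 - L * (M.ηc * M.ηl) * (M.To + 1)) * M.avgGradSq μ k
      + (M.ηc * M.ηl) * L ^ 2 / n * (M.drift μ k + (M.To + 1) * M.consErr μ k)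
      + L * (M.ηc * M.ηl) ^ 2 * ((M.To + 1) * σ ^ 2 / (n * b)) := by
  have hL := h.smoothness_pos
  set η := M.ηc * M.ηl with hηdef
  have hin : ∀ t ∈ Finset.range (M.To + 1), Integrable (fun ω =>
      inner ℝ (gradient (globalObj M.loss M.D) (colAvg (M.state k ω).X))
        (colAvg (M.noise k t ω))) μ := fun t ht =>
    h.integrable (((M.determinedBy_state_round k).prodMk (M.determinedBy_noise_round ht)).comp
      fun q => inner ℝ (gradient (globalObj M.loss M.D) (colAvg q.1.X)) (colAvg q.2))
  have h1 := integral_le_sum_mul_integral (μ := μ)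
    ![1, -(η * (M.To + 1) / 2), -(η * (1 / 2 - L * η * (M.To + 1))), η * L ^ 2 / n,
      η * L ^ 2 / n * (M.To + 1), L * η ^ 2, -η]
    ![fun ω => globalObj M.loss M.D (colAvg (M.state k ω).X),
      fun ω => ‖gradient (globalObj M.loss M.D) (colAvg (M.state k ω).X)‖ ^ 2,
      fun ω => ∑ t ∈ Finset.range (M.To + 1),
        ‖colAvg (gradStack M.loss M.D (M.localState k t ω).X)‖ ^ 2,
      fun ω => ∑ t ∈ Finset.range (M.To + 1),
        frobSq ((M.localState k t ω).X - (M.state k ω).X),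
      fun ω => frobSq (dev (M.state k ω).X),
      fun ω => ‖∑ t ∈ Finset.range (M.To + 1), colAvg (M.noise k t ω)‖ ^ 2,
      fun ω => ∑ t ∈ Finset.range (M.To + 1),
        inner ℝ (gradient (globalObj M.loss M.D) (colAvg (M.state k ω).X))
          (colAvg (M.noise k t ω))]
    (h.integrable_state (k + 1) fun s => globalObj M.loss M.D (colAvg s.X))
    (by
      intro i
      fin_cases i
      · exact h.integrable_state k fun s => globalObj M.loss M.D (colAvg s.X)
      · exact h.integrable_state k fun s => ‖gradient (globalObj M.loss M.D) (colAvg s.X)‖ ^ 2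
      · exact integrable_finsetSum _ fun t ht => h.integrable_avgGrad ht
      · exact integrable_finsetSum _ fun t ht => h.integrable_drift ht
      · exact h.integrable_state k fun s => frobSq (dev s.X)
      · refine h.integrable (N := (k + 1) * (M.To + 2) + 1) fun ω ω' e => ?_
        have e1 : ∀ t ∈ Finset.range (M.To + 1), colAvg (M.noise k t ω) = colAvg (M.noise k t ω') :=
          fun t ht => congrArg colAvg (M.determinedBy_noise_round ht ω ω' e)
        show ‖∑ t ∈ Finset.range (M.To + 1), colAvg (M.noise k t ω)‖ ^ 2
          = ‖∑ t ∈ Finset.range (M.To + 1), colAvg (M.noise k t ω')‖ ^ 2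
        rw [Finset.sum_congr rfl e1]
      · exact integrable_finsetSum _ hin)
    (fun ω => by
      have := h.globalObj_state_succ_le hη k ω
      rw [← hηdef] at this
      simp [Fin.sum_univ_succ] at this ⊢
      linarith)
  have h2 : ∫ ω, ∑ t ∈ Finset.range (M.To + 1),
      inner ℝ (gradient (globalObj M.loss M.D) (colAvg (M.state k ω).X))
        (colAvg (M.noise k t ω)) ∂μ = 0 := by
    rw [integral_finsetSum _ hin]
    exact Finset.sum_eq_zero fun t _ => h.integral_inner_gradient_noise k t
  have h3 := mul_le_mul_of_nonneg_left (h.integral_norm_sum_colAvg_noise_sq_le k)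
    (by positivity : 0 ≤ L * η ^ 2)
  have h4 : ∫ ω, ∑ t ∈ Finset.range (M.To + 1),
      ‖colAvg (gradStack M.loss M.D (M.localState k t ω).X)‖ ^ 2 ∂μ = M.avgGradSq μ k :=
    integral_finsetSum _ fun t ht => h.integrable_avgGrad ht
  have h5 : ∫ ω, ∑ t ∈ Finset.range (M.To + 1),
      frobSq ((M.localState k t ω).X - (M.state k ω).X) ∂μ = M.drift μ k :=
    integral_finsetSum _ fun t ht => h.integrable_drift ht
  rw [Fin.sum_univ_seven] at h1
  simp only [Matrix.cons_val, h2, h4, h5] at h1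
  unfold expObj gradSq consErr
  linarith

end Admissible

end Model

/-! ### Summing the recursions -/

lemma sum_le_of_contraction {lam : ℝ} (hlam : 0 < lam) {a r : ℕ → ℝ} (ha : ∀ k, 0 ≤ a k)
    (h : ∀ k, a (k + 1) ≤ (1 - lam / 2) * a k + r k) (K : ℕ) :
    ∑ k ∈ Finset.range K, a k ≤ 2 / lam * (a 0 + ∑ k ∈ Finset.range K, r k) := by
  have key : a K + lam / 2 * ∑ k ∈ Finset.range K, a k ≤ a 0 + ∑ k ∈ Finset.range K, r k := by
    induction K with
    | zero => simp
    | succ K ih =>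
      rw [Finset.sum_range_succ, Finset.sum_range_succ]
      linarith [h K]
  have h1 : ∑ k ∈ Finset.range K, a k = 2 / lam * (lam / 2 * ∑ k ∈ Finset.range K, a k) := by
    field_simp
  rw [h1]
  gcongr
  linarith [ha K]

/-- The search directions enter their own bound, through the drift, the consensus error and the
tracking error, with a total factor below one, which gives this bound without feedback. Here `w` is
the variance of one stochastic gradient, `Sh`, `Dh`, `Ph`, `Yh`, `Oh` are the sums over `K` rounds
of `dirSq`, `drift`, `avgGradSq`, `trackErr`, `consErr`, and `T = T_o + 1`; the step sizes enter
through `u = L η T`, `v = L ηl T_o`, and `q` bounds the share of the consensus error. -/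
lemma dirSq_bound_of_coupled_bounds {lam L η u v q T n w K E0 Sh Dh Ph Yh Oh : ℝ}
    (hlam : 0 < lam) (hlam1 : lam ≤ 1) (hT : 0 < T) (hn : 0 < n) (hw : 0 ≤ w) (hK : 0 ≤ K)
    (hE0 : 0 ≤ E0) (hSh : 0 ≤ Sh) (hPh : 0 ≤ Ph) (hu : u = L * η * T)
    (hu2 : u ^ 2 ≤ lam ^ 2 / 8100) (hv : v ^ 2 ≤ lam ^ 2 / 64800) (hq : q ≤ lam ^ 2 / 1350)
    (hO : L ^ 2 * (T * Oh) ≤ q * Sh) (hD : L ^ 2 * Dh ≤ v ^ 2 * Sh)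
    (hY : Yh ≤ 2 / lam * (E0
      + 3 / lam * (3 * L ^ 2 * (8 * Oh + 2 * η ^ 2 * T * Sh) + 6 * (n * (K * w)))))
    (hS : Sh ≤ 4 * T * Yh + 4 * L ^ 2 * Dh + 10 * T * (n * (K * w)) + 2 * n * Ph) :
    Sh ≤ 18 / lam * (T * E0) + 350 / lam ^ 2 * (T * (n * (K * w))) + 9 / 2 * (n * Ph) := by
  have hlam2 : lam ^ 2 ≤ 1 := pow_le_one₀ hlam.le hlam1
  have hY' : T * Yh ≤ 2 / lam * (T * E0) + Sh / 9 + 36 / lam ^ 2 * (T * (n * (K * w))) := by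
    have h1 := mul_le_mul_of_nonneg_left hY hT.le
    have h2 : T * (2 / lam * (E0
        + 3 / lam * (3 * L ^ 2 * (8 * Oh + 2 * η ^ 2 * T * Sh) + 6 * (n * (K * w)))))
        = 2 / lam * (T * E0) + 6 / lam ^ 2 * (24 * (L ^ 2 * (T * Oh)) + 6 * u ^ 2 * Sh)
          + 36 / lam ^ 2 * (T * (n * (K * w))) := by
      rw [hu]; field_simp; ring
    have h3 : 24 * (L ^ 2 * (T * Oh)) + 6 * u ^ 2 * Sh ≤ lam ^ 2 / 54 * Sh := by
      have h4 := mul_le_mul_of_nonneg_right hq hSh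
      have h5 := mul_le_mul_of_nonneg_right hu2 hSh
      have h6 : 0 ≤ lam ^ 2 * Sh := by positivity
      linarith
    have h4 : 6 / lam ^ 2 * (24 * (L ^ 2 * (T * Oh)) + 6 * u ^ 2 * Sh)
        ≤ 6 / lam ^ 2 * (lam ^ 2 / 54 * Sh) := mul_le_mul_of_nonneg_left h3 (by positivity)
    have h5 : 6 / lam ^ 2 * (lam ^ 2 / 54 * Sh) = Sh / 9 := by field_simp; ring
    linarith
  have hv1 : v ^ 2 * Sh ≤ 1 / 64800 * Sh := mul_le_mul_of_nonneg_right (by linarith) hSh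
  set B := T * (n * (K * w)) with hB
  have hB0 : 0 ≤ B := by positivity
  have hB1 : B ≤ 1 / lam ^ 2 * B := by
    refine le_mul_of_one_le_left hB0 ?_
    rw [le_div_iff₀ (by positivity)]
    linarith
  have e1 : 36 / lam ^ 2 * B = 36 * (1 / lam ^ 2 * B) := by ring
  have e2 : 350 / lam ^ 2 * B = 350 * (1 / lam ^ 2 * B) := by ring
  have e3 : 2 / lam * (T * E0) = 2 * (1 / lam * (T * E0)) := by ring
  have e4 : 18 / lam * (T * E0) = 18 * (1 / lam * (T * E0)) := by ring
  have e5 : 10 * T * (n * (K * w)) = 10 * B := by rw [hB]; ring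
  have e6 : 0 ≤ 1 / lam * (T * E0) := by positivity
  have e7 : 0 ≤ n * Ph := by positivity
  rw [e1, e3] at hY'
  rw [e5] at hS
  rw [e2, e4]
  linarith

set_option maxHeartbeats 800000 in
/-- The coupled bounds for the summed errors, solved for the summed squared gradients `Γ`, in the
notation of `dirSq_bound_of_coupled_bounds`. -/
lemma gradSq_bound_of_coupled_bounds {lam p L η ηl To T n w K E0 ft Γ Sh Dh Ph Yh Oh : ℝ}
    (hlam : 0 < lam) (hlam1 : lam ≤ 1) (hp0 : 0 ≤ p) (hp1 : p ≤ 1) (hη : 0 < η)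
    (hT : 0 < T) (hn : 0 < n) (hw : 0 ≤ w) (hK : 0 ≤ K) (hE0 : 0 ≤ E0)
    (hSh : 0 ≤ Sh) (hPh : 0 ≤ Ph)
    (hu : 0 ≤ L * η * T) (hu' : L * η * T ≤ lam ^ 2 / 90)
    (hv : (L * ηl * To) ^ 2 ≤ lam ^ 2 / 64800)
    (hO : Oh ≤ 2 / lam * ((1 - p) * (3 / lam) * η ^ 2 * T * Sh))
    (hY : Yh ≤ 2 / lam * (E0
      + 3 / lam * (3 * L ^ 2 * (8 * Oh + 2 * η ^ 2 * T * Sh) + 6 * (n * (K * w)))))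
    (hS : Sh ≤ 4 * T * Yh + 4 * L ^ 2 * Dh + 10 * T * (n * (K * w)) + 2 * n * Ph)
    (hD : Dh ≤ ηl ^ 2 * To ^ 2 * Sh)
    (hF : η * T / 2 * Γ ≤ ft - η * (1 / 2 - L * η * T) * Ph + η * L ^ 2 / n * (Dh + T * Oh)
      + K * (L * η ^ 2 * (T * w / n))) :
    η * T * Γ ≤ 2 * ft + η * T * E0 / n
      + 700 * η * T * K * w * ((L * ηl * To) ^ 2 / lam ^ 2
        + 6 * (1 - p) * (L * η * T) ^ 2 / lam ^ 4)
      + 2 * K * (L * η ^ 2 * (T * w / n)) := by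
  have hO' : L ^ 2 * (T * Oh) ≤ 6 * (1 - p) * (L * η * T) ^ 2 / lam ^ 2 * Sh := by
    have h1 := mul_le_mul_of_nonneg_left (mul_le_mul_of_nonneg_left hO hT.le) (sq_nonneg L)
    refine h1.trans (le_of_eq ?_)
    field_simp
    ring
  have hD' : L ^ 2 * Dh ≤ (L * ηl * To) ^ 2 * Sh := by
    have h1 := mul_le_mul_of_nonneg_left hD (sq_nonneg L)
    linarith
  obtain ⟨u, hudef⟩ : ∃ u, u = L * η * T := ⟨_, rfl⟩
  obtain ⟨v, hvdef⟩ : ∃ v, v = L * ηl * To := ⟨_, rfl⟩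
  obtain ⟨q, hq⟩ : ∃ q, q = 6 * (1 - p) * u ^ 2 / lam ^ 2 := ⟨_, rfl⟩
  rw [← hudef] at hu hu' hF hO' ⊢
  rw [← hvdef] at hv hD' ⊢
  rw [← hq] at hO'
  have hlam2 : lam ^ 2 ≤ 1 := pow_le_one₀ hlam.le hlam1
  have hp : 0 ≤ 1 - p := by linarith
  have hu2 : u ^ 2 / lam ^ 2 ≤ lam ^ 2 / 8100 := by
    rw [div_le_iff₀ (by positivity)]
    calc u ^ 2 ≤ (lam ^ 2 / 90) ^ 2 := pow_le_pow_left₀ hu hu' 2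
      _ = lam ^ 2 / 8100 * lam ^ 2 := by ring
  have hu3 : u ^ 2 ≤ lam ^ 2 / 8100 :=
    calc u ^ 2 = u ^ 2 / lam ^ 2 * lam ^ 2 := by field_simp
      _ ≤ u ^ 2 / lam ^ 2 * 1 := mul_le_mul_of_nonneg_left hlam2 (by positivity)
      _ ≤ lam ^ 2 / 8100 := by linarith
  have hq0 : 0 ≤ q := by rw [hq]; positivity
  have hq1 : q ≤ lam ^ 2 / 1350 :=
    calc q = 6 * (1 - p) * (u ^ 2 / lam ^ 2) := by rw [hq]; ring
      _ ≤ 6 * 1 * (lam ^ 2 / 8100) := by gcongr; linarith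
      _ = lam ^ 2 / 1350 := by ring
  have hS' := dirSq_bound_of_coupled_bounds hlam hlam1 hT hn hw hK hE0 hSh hPh hudef hu3 hv hq1 hO'
    hD' hY hS
  have hr0 : 0 ≤ v ^ 2 + q := by positivity
  have hr1 : v ^ 2 + q ≤ lam ^ 2 / 1000 := by
    have := sq_nonneg lam
    linarith
  have hqq : (v ^ 2 + q) / lam ^ 2 = v ^ 2 / lam ^ 2 + 6 * (1 - p) * u ^ 2 / lam ^ 4 := by
    rw [hq]; field_simp
  rw [← hqq]
  have hDO : L ^ 2 * Dh + L ^ 2 * (T * Oh) ≤ (v ^ 2 + q) * Sh := by linarith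
  generalize v ^ 2 + q = r at *
  have hmain : η * L ^ 2 / n * (Dh + T * Oh)
      ≤ η * T * E0 / n / 2 + 350 * η * T * K * w * (r / lam ^ 2) + η / 100 * Ph := by
    have h1 : η * L ^ 2 / n * (Dh + T * Oh) ≤ η / n * (r * Sh) := by
      have e1 : η * L ^ 2 / n * (Dh + T * Oh) = η / n * (L ^ 2 * Dh + L ^ 2 * (T * Oh)) := by ring
      rw [e1]
      exact mul_le_mul_of_nonneg_left hDO (by positivity)
    have h2 := mul_le_mul_of_nonneg_left (mul_le_mul_of_nonneg_left hS' hr0)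
      (by positivity : 0 ≤ η / n)
    have h3 : η / n * (r *
        (18 / lam * (T * E0) + 350 / lam ^ 2 * (T * (n * (K * w))) + 9 / 2 * (n * Ph)))
        = η * T * E0 / n * (18 * (r / lam))
          + 350 * η * T * K * w * (r / lam ^ 2) + η * Ph * (9 / 2 * r) := by
      field_simp
    have h4 : η * T * E0 / n * (18 * (r / lam)) ≤ η * T * E0 / n * (1 / 2) := by
      refine mul_le_mul_of_nonneg_left ?_ (by positivity)
      have : r / lam ≤ 1 / 1000 := by
        rw [div_le_iff₀ hlam]; nlinarith
      linarith
    have h5 : η * Ph * (9 / 2 * r) ≤ η * Ph * (1 / 100) :=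
      mul_le_mul_of_nonneg_left (by linarith) (by positivity)
    linarith
  have hP : η / 100 * Ph ≤ η * (1 / 2 - u) * Ph := by
    have h1 : (1 : ℝ) / 100 ≤ 1 / 2 - u := by linarith
    have h2 := mul_le_mul_of_nonneg_right (mul_le_mul_of_nonneg_left h1 hη.le) hPh
    linarith
  linarith

/-- The noise coefficient, with the powers of `λ_p` traded for `1 / α²` and `(1 - p) / s²`. -/
lemma noise_coefficient_le {lam p α s L A u : ℝ} (hlam : 0 < lam) (hp0 : 0 ≤ p) (hp1 : p ≤ 1)
    (hlamp : p ≤ lam) (hα : 1 ≤ α) (hs : s ^ 2 = (1 + p) * lam ^ 2) (hs0 : 0 < s) (hL : 0 < L)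
    (hA : 0 < A) (hu0 : 0 ≤ u) (hu : u ≤ 2 * (L * s * A)) :
    (L * A / α) ^ 2 / lam ^ 2 + 6 * (1 - p) * u ^ 2 / lam ^ 4
      ≤ 4 * (L ^ 2 * A ^ 2 / α ^ 2) + 100 * ((1 - p) * L ^ 2 * A ^ 2 / s ^ 2) := by
  have hp : 0 ≤ 1 - p := by linarith
  have e1 : 6 * (1 - p) * u ^ 2 / lam ^ 4
      ≤ 6 * (1 - p) * (2 * (L * s * A)) ^ 2 / lam ^ 4 := by gcongr
  have e2 : 6 * (1 - p) * (2 * (L * s * A)) ^ 2 / lam ^ 4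
      = (1 - p) * L ^ 2 * A ^ 2 / s ^ 2 * (24 * (1 + p) ^ 2) := by
    have : s ^ 4 = (1 + p) ^ 2 * lam ^ 4 := by
      rw [show s ^ 4 = (s ^ 2) ^ 2 by ring, hs]; ring
    field_simp
    rw [this]
    ring
  have e3 : (1 - p) * L ^ 2 * A ^ 2 / s ^ 2 * (24 * (1 + p) ^ 2)
      ≤ (1 - p) * L ^ 2 * A ^ 2 / s ^ 2 * 96 := by
    refine mul_le_mul_of_nonneg_left ?_ (by positivity)
    nlinarith
  -- either `1 - p ≥ 1 / 2`, or `λ_p ≥ p ≥ 1 / 2`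
  have e4 : (L * A / α) ^ 2 / lam ^ 2
      ≤ 4 * (L ^ 2 * A ^ 2 / α ^ 2) + 4 * ((1 - p) * L ^ 2 * A ^ 2 / s ^ 2) := by
    rcases le_total p (1 / 2) with hp2 | hp2
    · have f1 : (L * A / α) ^ 2 / lam ^ 2 ≤ (L * A) ^ 2 / lam ^ 2 := by
        gcongr
        exact div_le_self (by positivity) hα
      have f2 : (L * A) ^ 2 / lam ^ 2 = L ^ 2 * A ^ 2 / s ^ 2 * (1 + p) := by
        rw [hs]; field_simp
      have f3 : (1 - p) * L ^ 2 * A ^ 2 / s ^ 2 = L ^ 2 * A ^ 2 / s ^ 2 * (1 - p) := by ring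
      have f4 : L ^ 2 * A ^ 2 / s ^ 2 * (1 + p) ≤ L ^ 2 * A ^ 2 / s ^ 2 * (4 * (1 - p)) :=
        mul_le_mul_of_nonneg_left (by linarith) (by positivity)
      have f5 : 0 ≤ L ^ 2 * A ^ 2 / α ^ 2 := by positivity
      rw [f3]
      linarith
    · have f1 : 1 / 2 ≤ lam := by linarith
      have f2 : (L * A / α) ^ 2 / lam ^ 2 ≤ (L * A / α) ^ 2 / (1 / 2) ^ 2 := by gcongr
      have f3 : (L * A / α) ^ 2 / (1 / 2) ^ 2 = 4 * (L ^ 2 * A ^ 2 / α ^ 2) := by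
        field_simp; norm_num
      have f4 : 0 ≤ (1 - p) * L ^ 2 * A ^ 2 / s ^ 2 := by positivity
      linarith
  linarith

namespace Model

namespace Admissible

variable {n d m b : ℕ} {S Ω : Type*} [MeasurableSpace Ω] {M : Model n d m b S Ω} {μ : Measure Ω}
  [IsProbabilityMeasure μ] {p L σ : ℝ}

omit [IsProbabilityMeasure μ] in
lemma consErr_zero (h : M.Admissible μ p L σ) : M.consErr μ 0 = 0 := by
  have h1 : ∀ ω, dev (M.state 0 ω).X = 0 := fun ω => dev_const h.agents_pos M.x0
  simp [consErr, h1]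

lemma expObj_zero (h : M.Admissible μ p L σ) : M.expObj μ 0 = globalObj M.loss M.D M.x0 := by
  have h1 : ∀ ω, colAvg (M.state 0 ω).X = M.x0 := fun ω => colAvg_const h.agents_pos M.x0
  simp [expObj, h1]

/-- The average squared gradient over `K` rounds, for step sizes `ηc = α s` and
`ηl = A / (α T_o)` with `s = √(1+p) λ_p` and `A` at most `s / (360 L)`. -/
theorem average_gradSq_le (h : M.Admissible μ p L σ) {fstar α s A : ℝ}
    (hf : ∀ x, fstar ≤ globalObj M.loss M.D x) (hα : 1 ≤ α) (hTo : 0 < M.To)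
    (hs : s = √(1 + p) * expectedMixingRate p M.W) (hA : 0 < A) (hA' : A ≤ s / (360 * L))
    (hηl : M.ηl = A / (α * M.To)) (hηc : M.ηc = α * s) {K : ℕ} (hK : 0 < K) :
    1 / (K : ℝ) * ∑ k ∈ Finset.range K, M.gradSq μ k
      ≤ 2 * ((globalObj M.loss M.D M.x0 - fstar) / (s * A * K)) + M.trackErr μ 0 / (n * K)
        + 2 * (L * s * A * (σ ^ 2 / b) / (M.To * n)) + 2800 * (L ^ 2 * A ^ 2 * (σ ^ 2 / b) / α ^ 2)
        + 70000 * ((1 - p) * L ^ 2 * A ^ 2 * (σ ^ 2 / b) / s ^ 2) := by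
  have hlam := h.rate_pos
  have hlam1 := h.rate_le_one
  have hlamp := h.one_sub_rate_le
  have hL := h.smoothness_pos
  have hp0 := h.prob_nonneg
  have hp1 := h.prob_le_one
  have hn : (0 : ℝ) < n := by exact_mod_cast h.agents_pos
  have hb : (0 : ℝ) < b := by exact_mod_cast h.batch_pos
  have hTo' : (1 : ℝ) ≤ M.To := by exact_mod_cast hTo
  have hK' : (0 : ℝ) < K := by exact_mod_cast hK
  have hw : 0 ≤ σ ^ 2 / (b : ℝ) := by positivity
  set lam := expectedMixingRate p M.W with hlamdef
  set w := σ ^ 2 / (b : ℝ) with hwdef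
  have hs2 : s ^ 2 = (1 + p) * lam ^ 2 := by
    rw [hs, mul_pow, Real.sq_sqrt (by linarith)]
  have hs0 : 0 < s := by rw [hs]; positivity
  set η := M.ηc * M.ηl with hηdef
  have hη : η = s * A / M.To := by
    rw [hηdef, hηl, hηc]; field_simp
  have hη0 : 0 < η := by rw [hη]; positivity
  set T : ℝ := M.To + 1 with hTdef
  have hT0 : 0 < T := by positivity
  have hLA : L * A ≤ s / 360 := by
    rw [le_div_iff₀ (by positivity)] at hA'; linarith
  have hηT : η * T ≤ 2 * (s * A) := by
    rw [hη, div_mul_eq_mul_div, div_le_iff₀ (by positivity)]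
    have : 0 < s * A := by positivity
    nlinarith
  have hηT' : s * A ≤ η * T := by
    rw [hη, div_mul_eq_mul_div, le_div_iff₀ (by positivity)]
    have : 0 < s * A := by positivity
    nlinarith
  have hu0 : 0 ≤ L * η * T := by positivity
  have hu1 : L * η * T ≤ 2 * (L * s * A) := by
    have := mul_le_mul_of_nonneg_left hηT hL.le
    linarith
  have hu2 : L * η * T ≤ lam ^ 2 / 90 := by
    have h1 := mul_le_mul_of_nonneg_left hLA hs0.le
    have h2 : (1 + p) * lam ^ 2 ≤ 2 * lam ^ 2 := by gcongr; linarith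
    have h3 : s * (s / 360) = s ^ 2 / 360 := by ring
    rw [h3, hs2] at h1
    linarith
  have hv : L * M.ηl * M.To = L * A / α := by
    rw [hηl]; field_simp
  have hv2 : (L * M.ηl * M.To) ^ 2 ≤ lam ^ 2 / 64800 := by
    rw [hv]
    have h1 : L * A / α ≤ s / 360 := (div_le_self (by positivity) hα).trans hLA
    calc (L * A / α) ^ 2 ≤ (s / 360) ^ 2 := by gcongr
      _ = (1 + p) * lam ^ 2 / 129600 := by rw [div_pow, hs2]; norm_num
      _ ≤ lam ^ 2 / 64800 := by nlinarith [sq_nonneg lam]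
  have hE0 : 0 ≤ M.trackErr μ 0 := integral_nonneg fun ω => frobSq_nonneg _
  have hSnn : ∀ k, 0 ≤ M.dirSq μ k := fun k =>
    Finset.sum_nonneg fun t _ => integral_nonneg fun ω => frobSq_nonneg _
  have hPnn : ∀ k, 0 ≤ M.avgGradSq μ k := fun k =>
    Finset.sum_nonneg fun t _ => integral_nonneg fun ω => sq_nonneg _
  have hO := sum_le_of_contraction hlam (a := M.consErr μ)
    (fun k => integral_nonneg fun ω => frobSq_nonneg _) h.consErr_succ_le K
  rw [h.consErr_zero, zero_add, ← Finset.mul_sum] at hO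
  have hY := sum_le_of_contraction hlam (a := M.trackErr μ)
    (fun k => integral_nonneg fun ω => frobSq_nonneg _) h.trackErr_succ_le K
  simp only [← Finset.mul_sum, Finset.sum_add_distrib, Finset.sum_const, Finset.card_range,
    nsmul_eq_mul] at hY
  have hS := Finset.sum_le_sum fun k (_ : k ∈ Finset.range K) => h.dirSq_le k
  simp only [← Finset.mul_sum, Finset.sum_add_distrib, Finset.sum_const, Finset.card_range,
    nsmul_eq_mul] at hS
  have hD := Finset.sum_le_sum fun k (_ : k ∈ Finset.range K) => h.drift_le k
  rw [← Finset.mul_sum] at hD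
  have hF : η * T / 2 * ∑ k ∈ Finset.range K, M.gradSq μ k
      ≤ (globalObj M.loss M.D M.x0 - fstar)
        - η * (1 / 2 - L * η * T) * ∑ k ∈ Finset.range K, M.avgGradSq μ k
        + η * L ^ 2 / n * (∑ k ∈ Finset.range K, M.drift μ k
          + T * ∑ k ∈ Finset.range K, M.consErr μ k)
        + K * (L * η ^ 2 * (T * w / n)) := by
    have h1 := Finset.sum_le_sum fun k (_ : k ∈ Finset.range K) => h.expObj_succ_le hη0.le k
    simp only [← Finset.mul_sum, Finset.sum_add_distrib, Finset.sum_sub_distrib, Finset.sum_const,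
      Finset.card_range, nsmul_eq_mul] at h1
    have h2 := Finset.sum_range_succ (M.expObj μ) K
    rw [Finset.sum_range_succ', h.expObj_zero] at h2
    have h3 : fstar ≤ M.expObj μ K := by
      have := integral_mono (μ := μ) (integrable_const fstar)
        (h.integrable_state K fun s => globalObj M.loss M.D (colAvg s.X)) fun ω => hf _
      simpa [expObj] using this
    have h4 : (M.To + 1) * σ ^ 2 / (n * b) = T * w / n := by
      rw [hwdef]; field_simp; ring
    rw [h4] at h1
    linarith
  have key := gradSq_bound_of_coupled_bounds (ηl := M.ηl) (To := M.To) hlam hlam1 hp0 hp1 hη0 hT0 hn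
    hw hK'.le hE0 (Finset.sum_nonneg fun k (_ : k ∈ Finset.range K) => hSnn k)
    (Finset.sum_nonneg fun k (_ : k ∈ Finset.range K) => hPnn k) hu0 hu2 hv2 hO hY
    hS hD hF
  rw [hv] at key
  have hr := noise_coefficient_le hlam hp0 hp1 (by linarith) hα hs2 hs0 hL hA hu0 hu1
  have hft : 0 ≤ globalObj M.loss M.D M.x0 - fstar := sub_nonneg.2 (hf _)
  set ft := globalObj M.loss M.D M.x0 - fstar
  have hfin : 1 / (K : ℝ) * ∑ k ∈ Finset.range K, M.gradSq μ k
      ≤ 2 * (ft / (η * T * K)) + M.trackErr μ 0 / (n * K)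
        + 700 * w * ((L * A / α) ^ 2 / lam ^ 2 + 6 * (1 - p) * (L * η * T) ^ 2 / lam ^ 4)
        + 2 * (L * η * w / n) := by
    have e1 : 1 / (K : ℝ) * ∑ k ∈ Finset.range K, M.gradSq μ k
        = (η * T * ∑ k ∈ Finset.range K, M.gradSq μ k) / (η * T * K) := by
      field_simp
    rw [e1, div_le_iff₀ (by positivity)]
    refine key.trans (le_of_eq ?_)
    field_simp
  have g1 : ft / (η * T * K) ≤ ft / (s * A * K) := by gcongr
  have g2 : 700 * w * ((L * A / α) ^ 2 / lam ^ 2 + 6 * (1 - p) * (L * η * T) ^ 2 / lam ^ 4)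
      ≤ 700 * w * (4 * (L ^ 2 * A ^ 2 / α ^ 2) + 100 * ((1 - p) * L ^ 2 * A ^ 2 / s ^ 2)) := by
    gcongr
  have g3 : 700 * w * (4 * (L ^ 2 * A ^ 2 / α ^ 2) + 100 * ((1 - p) * L ^ 2 * A ^ 2 / s ^ 2))
      = 2800 * (L ^ 2 * A ^ 2 * w / α ^ 2) + 70000 * ((1 - p) * L ^ 2 * A ^ 2 * w / s ^ 2) := by
    ring
  have g4 : L * η * w / n = L * s * A * w / (M.To * n) := by
    rw [hη]; field_simp
  rw [g4] at hfin
  linarith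

end Admissible

end Model

/-! ### Step sizes and rates -/

section Rates

lemma rpow_half_sq {x : ℝ} (hx : 0 ≤ x) : (x ^ (1 / 2 : ℝ)) ^ 2 = x := by
  rw [← Real.rpow_natCast, ← Real.rpow_mul hx]; norm_num

lemma rpow_third_cube {x : ℝ} (hx : 0 ≤ x) : (x ^ (1 / 3 : ℝ)) ^ 3 = x := by
  rw [← Real.rpow_natCast, ← Real.rpow_mul hx]; norm_num

lemma rpow_two_thirds_cube {x : ℝ} (hx : 0 ≤ x) : (x ^ (2 / 3 : ℝ)) ^ 3 = x ^ 2 := by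
  rw [← Real.rpow_natCast, ← Real.rpow_mul hx, ← Real.rpow_natCast]; norm_num

variable {n b To K L σ α ft s a r : ℝ}

/-- The first step size balances the optimization error with the averaged gradient noise. -/
lemma balance_noise (hn : 0 < n) (hb : 0 < b) (hTo : 0 < To) (hK : 0 < K) (hL : 0 < L) (hσ : 0 < σ)
    (hft : 0 < ft) (hs : 0 < s) (ha : 0 < a) (hr : 0 ≤ r)
    (ha2 : a ^ 2 = n * b * To * ft / (s ^ 2 * L * σ ^ 2 * K))
    (hr2 : r ^ 2 = L * ft * σ ^ 2 / (n * To * b * K)) :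
    ft / (s * a * K) = r ∧ L * s * a * (σ ^ 2 / b) / (To * n) = r := by
  constructor
  · refine (pow_left_inj₀ (by positivity) hr two_ne_zero).1 ?_
    rw [hr2, div_pow, mul_pow, mul_pow, ha2]
    field_simp
  · refine (pow_left_inj₀ (by positivity) hr two_ne_zero).1 ?_
    rw [hr2, div_pow, mul_pow, mul_pow, ha2]
    field_simp

/-- The third step size balances the optimization error with the client drift. -/
lemma balance_drift (hb : 0 < b) (hK : 0 < K) (hL : 0 < L) (hσ : 0 < σ) (hα : 0 < α)
    (hft : 0 < ft) (hs : 0 < s) (ha : 0 < a) (hr : 0 ≤ r)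
    (ha3 : a ^ 3 = α ^ 2 * b * ft / (s * L ^ 2 * σ ^ 2 * K))
    (hr3 : r ^ 3 = (L * ft * σ / (α * s * √b * K)) ^ 2) :
    ft / (s * a * K) = r ∧ L ^ 2 * a ^ 2 * (σ ^ 2 / b) / α ^ 2 = r := by
  have hr3' : r ^ 3 = L ^ 2 * ft ^ 2 * σ ^ 2 / (α ^ 2 * s ^ 2 * b * K ^ 2) := by
    rw [hr3, div_pow, mul_pow _ K, mul_pow _ (√b), Real.sq_sqrt hb.le]
    ring
  constructor
  · refine (pow_left_inj₀ (by positivity) hr three_ne_zero).1 ?_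
    rw [hr3', div_pow, mul_pow, mul_pow, ha3]
    field_simp
  · refine (pow_left_inj₀ (by positivity) hr three_ne_zero).1 ?_
    have : (L ^ 2 * a ^ 2 * (σ ^ 2 / b) / α ^ 2) ^ 3
        = L ^ 6 * (a ^ 3) ^ 2 * (σ ^ 2 / b) ^ 3 / α ^ 6 := by ring
    rw [hr3', this, ha3]
    field_simp

/-- The second step size balances the optimization error with the consensus error. -/
lemma balance_consensus {p : ℝ} (hp : p < 1) (hb : 0 < b) (hK : 0 < K) (hL : 0 < L) (hσ : 0 < σ)
    (hft : 0 < ft) (hs : 0 < s) (ha : 0 < a) (hr : 0 ≤ r)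
    (ha3 : a ^ 3 = s * b * ft / ((1 - p) * L ^ 2 * σ ^ 2 * K))
    (hr3 : r ^ 3 = (√(1 - p) * L * ft * σ / (s ^ 2 * √b * K)) ^ 2) :
    ft / (s * a * K) = r ∧ (1 - p) * L ^ 2 * a ^ 2 * (σ ^ 2 / b) / s ^ 2 = r := by
  have hp' : 0 < 1 - p := by linarith
  generalize 1 - p = q at *
  have hr3' : r ^ 3 = q * L ^ 2 * ft ^ 2 * σ ^ 2 / (s ^ 4 * b * K ^ 2) := by
    rw [hr3, div_pow, mul_pow _ K, mul_pow _ (√b), Real.sq_sqrt hb.le, mul_pow _ σ, mul_pow _ ft,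
      mul_pow _ L, Real.sq_sqrt hp'.le]
    ring
  constructor
  · refine (pow_left_inj₀ (by positivity) hr three_ne_zero).1 ?_
    rw [hr3', div_pow, mul_pow, mul_pow, ha3]
    field_simp
  · refine (pow_left_inj₀ (by positivity) hr three_ne_zero).1 ?_
    have : (q * L ^ 2 * a ^ 2 * (σ ^ 2 / b) / s ^ 2) ^ 3
        = q ^ 3 * L ^ 6 * (a ^ 3) ^ 2 * (σ ^ 2 / b) ^ 3 / s ^ 6 := by ring
    rw [hr3', this, ha3]
    field_simp

end Rates

/-- The minimum of the three candidates in `localStepSize`, without the prefactor. -/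
noncomputable def stepMin (n b To : ℕ) (p lam L σ α ft : ℝ) (K : ℕ) : ℝ :=
  let A₁ := (n * b * To * ft / ((1 + p) * lam ^ 2 * L * σ ^ 2 * K)) ^ (1 / 2 : ℝ)
  let A₂ := (√(1 + p) * lam * b * ft / ((1 - p) * L ^ 2 * σ ^ 2 * K)) ^ (1 / 3 : ℝ)
  let A₃ := (α ^ 2 * b * ft / (√(1 + p) * lam * L ^ 2 * σ ^ 2 * K)) ^ (1 / 3 : ℝ)
  if p < 1 then min A₁ (min A₂ A₃) else min A₁ A₃

lemma localStepSize_eq (n b To : ℕ) (p lam L σ α ft : ℝ) (K : ℕ) :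
    localStepSize n b To p lam L σ α ft K = stepMin n b To p lam L σ α ft K / (α * To) := by
  rw [localStepSize, stepMin]; ring

/-- What remains of the convergence bound once the step size is inserted. -/
lemma bound_le_rate {n b To K : ℕ} {p lam L σ α ft s E0 : ℝ} (hn : 0 < n) (hb : 0 < b)
    (hTo : 0 < To) (hK : 0 < K) (hp0 : 0 ≤ p) (hp1 : p ≤ 1) (hlam : 0 < lam) (hL : 0 < L)
    (hσ : 0 < σ) (hα : 1 ≤ α) (hft : 0 < ft) (hE0 : 0 ≤ E0) (hs : s = √(1 + p) * lam) :
    0 < stepMin n b To p lam L σ α ft K ∧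
    2 * (ft / (s * stepMin n b To p lam L σ α ft K * K)) + E0 / (n * K)
        + 2 * (L * s * stepMin n b To p lam L σ α ft K * (σ ^ 2 / b) / (To * n))
        + 2800 * (L ^ 2 * stepMin n b To p lam L σ α ft K ^ 2 * (σ ^ 2 / b) / α ^ 2)
        + 70000 * ((1 - p) * L ^ 2 * stepMin n b To p lam L σ α ft K ^ 2 * (σ ^ 2 / b) / s ^ 2)
      ≤ 70002 * rate n b To p lam L σ α ft E0 K := by
  have hn' : (0 : ℝ) < n := by exact_mod_cast hn
  have hb' : (0 : ℝ) < b := by exact_mod_cast hb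
  have hTo' : (0 : ℝ) < To := by exact_mod_cast hTo
  have hK' : (0 : ℝ) < K := by exact_mod_cast hK
  have hα' : 0 < α := by linarith
  have hp : 0 ≤ 1 - p := by linarith
  have hs0 : 0 < s := by rw [hs]; positivity
  have hs2 : s ^ 2 = (1 + p) * lam ^ 2 := by
    rw [hs, mul_pow, Real.sq_sqrt (by linarith)]
  have hαs : α * √(1 + p) * lam = α * s := by rw [hs]; ring
  set A := stepMin n b To p lam L σ α ft K with hAdef
  rw [stepMin] at hAdef
  rw [rate, leadingRate, hαs, ← hs2]
  rw [← hs2, ← hs] at hAdef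
  have hx1 : 0 < n * b * To * ft / (s ^ 2 * L * σ ^ 2 * K) := by positivity
  have hx3 : 0 < α ^ 2 * b * ft / (s * L ^ 2 * σ ^ 2 * K) := by positivity
  have hy1 : 0 ≤ L * ft * σ ^ 2 / (n * To * b * K) := by positivity
  have hy2 : 0 ≤ L * ft * σ / (α * s * √b * K) := by positivity
  have hy3 : 0 ≤ √(1 - p) * L * ft * σ / (s ^ 2 * √b * K) := by positivity
  set A₁ := (n * b * To * ft / (s ^ 2 * L * σ ^ 2 * K)) ^ (1 / 2 : ℝ) with hA1
  set A₂ := (s * b * ft / ((1 - p) * L ^ 2 * σ ^ 2 * K)) ^ (1 / 3 : ℝ) with hA2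
  set A₃ := (α ^ 2 * b * ft / (s * L ^ 2 * σ ^ 2 * K)) ^ (1 / 3 : ℝ) with hA3
  set r1 := (L * ft * σ ^ 2 / (n * To * b * K)) ^ (1 / 2 : ℝ) with hr1
  set r2 := (L * ft * σ / (α * s * √b * K)) ^ (2 / 3 : ℝ) with hr2
  set r3 := (√(1 - p) * L * ft * σ / (s ^ 2 * √b * K)) ^ (2 / 3 : ℝ) with hr3
  have hA1p : 0 < A₁ := Real.rpow_pos_of_pos hx1 _
  have hA3p : 0 < A₃ := Real.rpow_pos_of_pos hx3 _
  have hr1p : 0 ≤ r1 := Real.rpow_nonneg hy1 _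
  have hr2p : 0 ≤ r2 := Real.rpow_nonneg hy2 _
  have hr3p : 0 ≤ r3 := Real.rpow_nonneg hy3 _
  have hE : 0 ≤ E0 / (n * K) := by positivity
  obtain ⟨b1, b1'⟩ := balance_noise hn' hb' hTo' hK' hL hσ hft hs0 hA1p hr1p
    (rpow_half_sq hx1.le) (rpow_half_sq hy1)
  obtain ⟨b3, b3'⟩ := balance_drift hb' hK' hL hσ hα' hft hs0 hA3p hr2p
    (rpow_third_cube hx3.le) (rpow_two_thirds_cube hy2)
  -- monotonicity in the step size of the three noise terms
  have m1 : ∀ x, 0 < x → A ≤ x →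
      L * s * A * (σ ^ 2 / b) / (To * n) ≤ L * s * x * (σ ^ 2 / b) / (To * n) := by
    intro x _ hx; gcongr
  have m2 : ∀ x, 0 < A → A ≤ x →
      L ^ 2 * A ^ 2 * (σ ^ 2 / b) / α ^ 2 ≤ L ^ 2 * x ^ 2 * (σ ^ 2 / b) / α ^ 2 := by
    intro x _ hx; gcongr
  have m3 : ∀ x, 0 < A → A ≤ x → (1 - p) * L ^ 2 * A ^ 2 * (σ ^ 2 / b) / s ^ 2
      ≤ (1 - p) * L ^ 2 * x ^ 2 * (σ ^ 2 / b) / s ^ 2 := by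
    intro x _ hx; gcongr
  rcases lt_or_eq_of_le hp1 with hp1 | rfl
  · rw [if_pos hp1] at hAdef
    have hp' : 0 < 1 - p := by linarith
    have hx2 : 0 < s * b * ft / ((1 - p) * L ^ 2 * σ ^ 2 * K) := by positivity
    have hA2p : 0 < A₂ := Real.rpow_pos_of_pos hx2 _
    obtain ⟨b2, b2'⟩ := balance_consensus hp1 hb' hK' hL hσ hft hs0 hA2p hr3p
      (rpow_third_cube hx2.le) (rpow_two_thirds_cube hy3)
    have hA0 : 0 < A := by rw [hAdef]; exact lt_min hA1p (lt_min hA2p hA3p)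
    have l1 : A ≤ A₁ := by rw [hAdef]; exact min_le_left _ _
    have l2 : A ≤ A₂ := by rw [hAdef]; exact (min_le_right _ _).trans (min_le_left _ _)
    have l3 : A ≤ A₃ := by rw [hAdef]; exact (min_le_right _ _).trans (min_le_right _ _)
    have hopt : ft / (s * A * K) ≤ r1 + r2 + r3 := by
      have h3 : A = A₁ ∨ A = A₂ ∨ A = A₃ := by
        rw [hAdef]
        rcases min_choice A₁ (min A₂ A₃) with e | e <;> rw [e]
        · exact Or.inl rfl
        · exact Or.inr (min_choice _ _)
      rcases h3 with e | e | e <;> rw [e] <;> linarith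
    refine ⟨hA0, ?_⟩
    linarith [m1 A₁ hA1p l1, m2 A₃ hA0 l3, m3 A₂ hA0 l2]
  · rw [if_neg (lt_irrefl _)] at hAdef
    have hA0 : 0 < A := by rw [hAdef]; exact lt_min hA1p hA3p
    have l1 : A ≤ A₁ := by rw [hAdef]; exact min_le_left _ _
    have l3 : A ≤ A₃ := by rw [hAdef]; exact min_le_right _ _
    have hopt : ft / (s * A * K) ≤ r1 + r2 := by
      rcases min_choice A₁ A₃ with e | e <;> rw [hAdef, e] <;> linarith
    have h0 : (1 - 1 : ℝ) * L ^ 2 * A ^ 2 * (σ ^ 2 / b) / s ^ 2 = 0 := by simp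
    refine ⟨hA0, ?_⟩
    rw [h0]
    linarith [m1 A₁ hA1p l1, m2 A₃ hA0 l3]

/-- For sufficiently large `K` the step size meets the stability condition. -/
lemma stepMin_le {n b To K : ℕ} {p lam L σ α ft : ℝ} (hn : 0 < n) (hb : 0 < b)
    (hTo : 0 < To) (hK : 0 < K) (hp0 : 0 ≤ p) (hlam : 0 < lam) (hL : 0 < L)
    (hσ : 0 < σ) (hft : 0 < ft) (h : SufficientlyLarge n b To p lam L σ α ft K) :
    stepMin n b To p lam L σ α ft K ≤ √(1 + p) * lam / (360 * L) := by
  have hn' : (0 : ℝ) < n := by exact_mod_cast hn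
  have hb' : (0 : ℝ) < b := by exact_mod_cast hb
  have hTo' : (0 : ℝ) < To := by exact_mod_cast hTo
  have hK' : (0 : ℝ) < K := by exact_mod_cast hK
  have h1 : stepMin n b To p lam L σ α ft K
      ≤ (n * b * To * ft / ((1 + p) * lam ^ 2 * L * σ ^ 2 * K)) ^ (1 / 2 : ℝ) := by
    rw [stepMin]
    split_ifs <;> exact min_le_left _ _
  refine h1.trans ?_
  have hx : 0 ≤ n * b * To * ft / ((1 + p) * lam ^ 2 * L * σ ^ 2 * K) := by positivity
  refine le_of_sq_le_sq ?_ (by positivity)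
  rw [rpow_half_sq hx, div_pow, mul_pow, Real.sq_sqrt (by linarith)]
  have h2 := h.1
  rw [div_le_iff₀ (by positivity)] at h2
  rw [div_le_div_iff₀ (by positivity) (by positivity)]
  have h3 := mul_le_mul_of_nonneg_right h2 hL.le
  nlinarith

lemma stepMin_of_gap_eq_zero (n b To K : ℕ) (p lam L σ α : ℝ) :
    stepMin n b To p lam L σ α 0 K = 0 := by
  simp [stepMin]

lemma rate_nonneg {n b To K : ℕ} {p lam L σ α ft E0 : ℝ} (hp0 : 0 ≤ p) (hlam : 0 ≤ lam)
    (hL : 0 ≤ L) (hσ : 0 ≤ σ) (hα : 0 ≤ α) (hft : 0 ≤ ft) (hE0 : 0 ≤ E0) :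
    0 ≤ rate n b To p lam L σ α ft E0 K := by
  unfold rate leadingRate
  have := Real.sqrt_nonneg (1 - p)
  positivity

/-- If `K` exceeds the communication complexity with the constant `(4 C)²`, the rate with the
constant `C` is at most `ε²`. -/
lemma rate_le_of_complexity_le {n b To K : ℕ} {p lam L σ α ft E0 ε C : ℝ} (hn : 0 < n) (hb : 0 < b)
    (hTo : 0 < To) (hK : 0 < K) (hp0 : 0 ≤ p) (hlam : 0 < lam) (hL : 0 < L)
    (hσ : 0 < σ) (hα : 1 ≤ α) (hft : 0 ≤ ft) (hE0 : 0 ≤ E0) (hε : 0 < ε) (hC : 1 ≤ C)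
    (h : (4 * C) ^ 2 * complexity n b To p lam L σ α ft E0 ε ≤ K) :
    C * rate n b To p lam L σ α ft E0 K ≤ ε ^ 2 := by
  have hn' : (0 : ℝ) < n := by exact_mod_cast hn
  have hb' : (0 : ℝ) < b := by exact_mod_cast hb
  have hTo' : (0 : ℝ) < To := by exact_mod_cast hTo
  have hK' : (0 : ℝ) < K := by exact_mod_cast hK
  have hα' : 0 < α := by linarith
  set c := 4 * C with hc
  have hc1 : 1 ≤ c := by linarith
  have hc0 : 0 < c := by linarith
  -- one estimate for each shape of term
  have half : ∀ x, 0 ≤ x → c ^ 2 * (x / ε ^ 4) ≤ K → (x / K) ^ (1 / 2 : ℝ) ≤ ε ^ 2 / c := by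
    intro x hx hxK
    refine le_of_sq_le_sq ?_ (by positivity)
    rw [rpow_half_sq (by positivity), div_le_iff₀ hK']
    calc x = ε ^ 4 / c ^ 2 * (c ^ 2 * (x / ε ^ 4)) := by field_simp
      _ ≤ ε ^ 4 / c ^ 2 * K := by gcongr
      _ = (ε ^ 2 / c) ^ 2 * K := by ring
  have third : ∀ x, 0 ≤ x → c ^ 2 * (x / ε ^ 3) ≤ K → (x / K) ^ (2 / 3 : ℝ) ≤ ε ^ 2 / c := by
    intro x hx hxK
    refine le_of_pow_le_pow_left₀ three_ne_zero (by positivity) ?_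
    rw [rpow_two_thirds_cube (by positivity)]
    have h1 : x / K ≤ ε ^ 3 / c ^ 2 := by
      rw [div_le_iff₀ hK']
      calc x = ε ^ 3 / c ^ 2 * (c ^ 2 * (x / ε ^ 3)) := by field_simp
        _ ≤ ε ^ 3 / c ^ 2 * K := by gcongr
    calc (x / K) ^ 2 ≤ (ε ^ 3 / c ^ 2) ^ 2 := by gcongr
      _ = ε ^ 6 / (c ^ 3 * c) := by ring
      _ ≤ ε ^ 6 / (c ^ 3 * 1) := by gcongr
      _ = (ε ^ 2 / c) ^ 3 := by ring
  have one : ∀ x, 0 ≤ x → c ^ 2 * (x / ε ^ 2) ≤ K → x / K ≤ ε ^ 2 / c := by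
    intro x hx hxK
    rw [div_le_iff₀ hK']
    calc x = ε ^ 2 / c ^ 2 * (c ^ 2 * (x / ε ^ 2)) := by field_simp
      _ ≤ ε ^ 2 / c ^ 2 * K := by gcongr
      _ = ε ^ 2 / (c * c) * K := by ring
      _ ≤ ε ^ 2 / (c * 1) * K := by gcongr
      _ = ε ^ 2 / c * K := by rw [mul_one]
  unfold complexity at h
  have q1 : 0 ≤ c ^ 2 * (L * ft * σ ^ 2 / (n * To * b * ε ^ 4)) := by positivity
  have q2 : 0 ≤ c ^ 2 * (L * ft * σ / (α * √(1 + p) * lam * √b * ε ^ 3)) := by positivity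
  have q3 : 0 ≤ c ^ 2 * (√(1 - p) * L * ft * σ / ((1 + p) * lam ^ 2 * √b * ε ^ 3)) := by positivity
  have q4 : 0 ≤ c ^ 2 * (E0 / (n * ε ^ 2)) := by positivity
  have t1 := half (L * ft * σ ^ 2 / (n * To * b)) (by positivity)
    (by rw [div_div]; linarith)
  have t2 := third (L * ft * σ / (α * √(1 + p) * lam * √b)) (by positivity)
    (by rw [div_div]; linarith)
  have t3 := third (√(1 - p) * L * ft * σ / ((1 + p) * lam ^ 2 * √b)) (by positivity)
    (by rw [div_div]; linarith)
  have t4 := one (E0 / n) (by positivity) (by rw [div_div]; linarith)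
  rw [div_div] at t1 t2 t3 t4
  have h4 : rate n b To p lam L σ α ft E0 K ≤ 4 * (ε ^ 2 / c) := by
    unfold rate leadingRate; linarith
  calc C * rate n b To p lam L σ α ft E0 K ≤ C * (4 * (ε ^ 2 / c)) := by gcongr
    _ = ε ^ 2 := by rw [hc]; field_simp

/-- A positive multiple of `K^{-1/2}` eventually dominates `(x / K)^{2/3}`. -/
lemma eventually_rpow_two_thirds_le {x y : ℝ} (hx : 0 ≤ x) (hy : 0 < y) :
    ∀ᶠ K : ℕ in Filter.atTop, (x / K) ^ (2 / 3 : ℝ) ≤ (y / K) ^ (1 / 2 : ℝ) := by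
  have h1 : Filter.Tendsto (fun K : ℕ => (K : ℝ)) Filter.atTop Filter.atTop :=
    tendsto_natCast_atTop_atTop
  filter_upwards [h1.eventually_ge_atTop (x ^ 4 / y ^ 3), Filter.eventually_gt_atTop 0]
    with K hK hK0
  have hK' : (0 : ℝ) < K := by exact_mod_cast hK0
  rw [div_le_iff₀ (by positivity)] at hK
  -- compare the sixth powers
  refine le_of_pow_le_pow_left₀ (n := 6) (by norm_num) (by positivity) ?_
  have e1 : ((x / K) ^ (2 / 3 : ℝ)) ^ 6 = (x / K) ^ 4 := by
    rw [show (6 : ℕ) = 3 * 2 by norm_num, pow_mul, rpow_two_thirds_cube (by positivity), ← pow_mul]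
  have e2 : ((y / K) ^ (1 / 2 : ℝ)) ^ 6 = (y / K) ^ 3 := by
    rw [show (6 : ℕ) = 2 * 3 by norm_num, pow_mul, rpow_half_sq (by positivity)]
  rw [e1, e2, div_pow, div_pow, div_le_div_iff₀ (by positivity) (by positivity)]
  calc x ^ 4 * (K : ℝ) ^ 3 ≤ (K * y ^ 3) * K ^ 3 := by gcongr
    _ = y ^ 3 * K ^ 4 := by ring

lemma eventually_div_le_rpow_half (x : ℝ) {y : ℝ} (hy : 0 < y) :
    ∀ᶠ K : ℕ in Filter.atTop, x / K ≤ (y / K) ^ (1 / 2 : ℝ) := by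
  have h1 : Filter.Tendsto (fun K : ℕ => (K : ℝ)) Filter.atTop Filter.atTop :=
    tendsto_natCast_atTop_atTop
  filter_upwards [h1.eventually_ge_atTop (x ^ 2 / y), Filter.eventually_gt_atTop 0] with K hK hK0
  have hK' : (0 : ℝ) < K := by exact_mod_cast hK0
  rw [div_le_iff₀ (by positivity)] at hK
  refine le_of_sq_le_sq ?_ (by positivity)
  rw [rpow_half_sq (by positivity), div_pow, div_le_div_iff₀ (by positivity) (by positivity)]
  nlinarith

/-- Eventually `K` is sufficiently large and the leading term dominates the rate. -/
lemma eventually_rate_le {n b To : ℕ} {p lam L σ α ft E0 : ℝ} (hn : 0 < n) (hb : 0 < b)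
    (hTo : 0 < To) (hp0 : 0 ≤ p) (hlam : 0 < lam) (hL : 0 < L)
    (hσ : 0 < σ) (hα : 1 ≤ α) (hft : 0 < ft) :
    ∀ᶠ K : ℕ in Filter.atTop, 0 < K ∧ SufficientlyLarge n b To p lam L σ α ft K ∧
      rate n b To p lam L σ α ft E0 K ≤ 4 * leadingRate n b To L σ ft K := by
  have hn' : (0 : ℝ) < n := by exact_mod_cast hn
  have hb' : (0 : ℝ) < b := by exact_mod_cast hb
  have hTo' : (0 : ℝ) < To := by exact_mod_cast hTo
  have hα' : 0 < α := by linarith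
  have h1 : Filter.Tendsto (fun K : ℕ => (K : ℝ)) Filter.atTop Filter.atTop :=
    tendsto_natCast_atTop_atTop
  have hy : 0 < L * ft * σ ^ 2 / (n * To * b) := by positivity
  filter_upwards [Filter.eventually_gt_atTop 0,
    h1.eventually_ge_atTop (360 ^ 2 * n * To * b * L * ft / ((1 + p) ^ 2 * lam ^ 4 * σ ^ 2)),
    h1.eventually_ge_atTop (360 ^ 3 * b * L * ft / ((1 - p ^ 2) * lam ^ 2 * σ ^ 2)),
    h1.eventually_ge_atTop (360 ^ 3 * α ^ 2 * b * L * ft / ((1 + p) ^ 2 * lam ^ 4 * σ ^ 2)),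
    eventually_rpow_two_thirds_le (x := L * ft * σ / (α * √(1 + p) * lam * √b))
      (by positivity) hy,
    eventually_rpow_two_thirds_le (x := √(1 - p) * L * ft * σ / ((1 + p) * lam ^ 2 * √b))
      (by positivity) hy,
    eventually_div_le_rpow_half (E0 / n) hy] with K h0 k1 k2 k3 t2 t3 t4
  rw [div_div, div_div] at t2 t3 t4
  refine ⟨h0, ⟨k1, fun _ => k2, k3⟩, ?_⟩
  unfold rate leadingRate
  linarith

namespace Model

namespace Admissible

variable {n d m b : ℕ} {S Ω : Type*} [MeasurableSpace Ω] {M : Model n d m b S Ω} {μ : Measure Ω}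
  {p L σ : ℝ}

/-- Without an initial gap the local step size vanishes and the average never leaves the
minimizer `x^0`. -/
lemma gradSq_eq_zero (h : M.Admissible μ p L σ) (hmin : ∀ x, globalObj M.loss M.D M.x0
    ≤ globalObj M.loss M.D x) (hηl : M.ηl = 0) (k : ℕ) : M.gradSq μ k = 0 := by
  have h1 : ∀ ω, colAvg (M.state k ω).X = M.x0 := by
    intro ω
    induction k with
    | zero => exact colAvg_const h.agents_pos M.x0
    | succ k ih => rw [h.colAvg_state_succ_X, hηl, ih]; simp
  have h2 : gradient (globalObj M.loss M.D) M.x0 = 0 := by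
    have h3 : IsLocalMin (globalObj M.loss M.D) M.x0 := Filter.Eventually.of_forall hmin
    rw [gradient, h3.fderiv_eq_zero, map_zero]
  simp [gradSq, h1, h2]

end Admissible

end Model

end PISCO

theorem corollary1 :
    ∃ C : ℝ, 0 < C ∧
      ∀ (n d m b To : ℕ) (_ : 0 < n) (_ : 0 < m) (_ : 0 < b) (_ : 0 < To)
        -- network and communication probability
        (G : SimpleGraph (Fin n)) (W : Matrix (Fin n) (Fin n) ℝ) (_ : PISCO.IsMixingMatrix G W)
        (p : ℝ) (_ : 0 ≤ p) (_ : p ≤ 1) (_ : 0 < PISCO.expectedMixingRate p W)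
        -- data, loss, smoothness, finite optimal value, starting point
        (S : Type*) (loss : PISCO.Vec d → S → ℝ) (D : Fin n → Fin m → S)
        (_ : ∀ i j, Differentiable ℝ (fun x => loss x (D i j)))
        (L : ℝ) (_ : 0 < L) (_ : PISCO.LSmooth loss D L)
        (fstar : ℝ) (_ : IsGLB (Set.range (PISCO.globalObj loss D)) fstar)
        (x0 : PISCO.Vec d)
        -- mini-batches and coins
        (Ω : Type*) [MeasurableSpace Ω] (μ : Measure Ω) [IsProbabilityMeasure μ]
        (Z : Fin n → ℕ → ℕ → Ω → Fin b → Fin m) (c : ℕ → Ω → Bool)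
        (_ : PISCO.IndependentDraws μ p Z c)
        (σ : ℝ) (_ : 0 < σ) (_ : PISCO.UnbiasedBoundedVariance μ loss D σ Z)
        (α : ℝ) (_ : 1 ≤ α),
        let lam : ℝ := PISCO.expectedMixingRate p W
        let ft : ℝ := PISCO.globalObj loss D x0 - fstar
        let E0 : ℝ := PISCO.initTrackingError μ loss D x0 Z
        -- the average squared gradient norm over `K` rounds with the step sizes chosen for `K`
        let err : ℕ → ℝ := fun K =>
          PISCO.avgGradNormSq μ loss D W x0 To
            (PISCO.localStepSize n b To p lam L σ α ft K) (PISCO.commStepSize p lam α) Z c K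
        -- convergence rate
        (∀ K : ℕ, 0 < K → PISCO.SufficientlyLarge n b To p lam L σ α ft K →
          err K ≤ C * PISCO.rate n b To p lam L σ α ft E0 K) ∧
        -- communication complexity
        (∀ ε : ℝ, 0 < ε → ∀ K : ℕ, 0 < K → PISCO.SufficientlyLarge n b To p lam L σ α ft K →
          C * PISCO.complexity n b To p lam L σ α ft E0 ε ≤ K → err K ≤ ε ^ 2) ∧
        -- linear speedup: eventually only the leading term matters
        (∃ K₀ : ℕ, ∀ K : ℕ, K₀ ≤ K → err K ≤ C * PISCO.leadingRate n b To L σ ft K) := by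
  refine ⟨(4 * 70002) ^ 2, by norm_num, ?_⟩
  intro n d m b To hn _ hb hTo G W hW p hp0 hp1 hlam S loss D _ L hL hsmooth fstar hfstar x0 Ω _ μ _
    Z c hdraws σ hσ hvar α hα lam ft E0 err
  have hmin : ∀ x, fstar ≤ PISCO.globalObj loss D x := fun x => hfstar.1 ⟨x, rfl⟩
  have hft0 : 0 ≤ ft := sub_nonneg.2 (hmin x0)
  have hE0 : 0 ≤ E0 := integral_nonneg fun ω => PISCO.frobSq_nonneg _
  let M : ℕ → PISCO.Model n d m b S Ω := fun K =>
    ⟨loss, D, W, x0, To, PISCO.localStepSize n b To p lam L σ α ft K,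
      PISCO.commStepSize p lam α, Z, c⟩
  have hM : ∀ K, (M K).Admissible μ p L σ := fun K =>
    ⟨hn, hb, hp0, hp1, hW.mem_doublyStochastic, hlam, hL, hsmooth, hdraws, hvar⟩
  have herr : ∀ K, err K = 1 / (K : ℝ) * ∑ k ∈ Finset.range K, (M K).gradSq μ k := fun K => rfl
  have hE0' : ∀ K, (M K).trackErr μ 0 = E0 := fun K =>
    integral_congr_ae (Filter.Eventually.of_forall fun ω =>
      congrArg PISCO.frobSq (PISCO.sub_mix_avgMatrix _).symm)
  have hgap : ft = 0 → ∀ K, err K = 0 := by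
    intro hft K
    have hηl : (M K).ηl = 0 := by
      show PISCO.localStepSize n b To p lam L σ α ft K = 0
      rw [PISCO.localStepSize_eq, hft, PISCO.stepMin_of_gap_eq_zero, zero_div]
    have hx0 : ∀ x, PISCO.globalObj loss D x0 ≤ PISCO.globalObj loss D x := fun x => by
      have h1 := hmin x
      have h2 : PISCO.globalObj loss D x0 - fstar = 0 := hft
      linarith
    rw [herr, Finset.sum_eq_zero fun k _ => (hM K).gradSq_eq_zero hx0 hηl k, mul_zero]
  have hrate : ∀ K : ℕ, 0 < K → PISCO.SufficientlyLarge n b To p lam L σ α ft K →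
      err K ≤ 70002 * PISCO.rate n b To p lam L σ α ft E0 K := by
    intro K hK hlarge
    rcases hft0.lt_or_eq with hft | hft
    · obtain ⟨hA, hbound⟩ := PISCO.bound_le_rate hn hb hTo hK hp0 hp1 hlam hL hσ hα hft hE0
        (s := √(1 + p) * lam) rfl
      refine le_trans ?_ hbound
      have key := (hM K).average_gradSq_le hmin hα hTo rfl hA
        (PISCO.stepMin_le hn hb hTo hK hp0 hlam hL hσ hft hlarge)
        (PISCO.localStepSize_eq n b To p lam L σ α ft K) (mul_assoc _ _ _) hK
      rw [hE0'] at key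
      exact key
    · rw [hgap hft.symm]
      exact mul_nonneg (by norm_num)
        (PISCO.rate_nonneg hp0 hlam.le hL.le hσ.le (by linarith) hft0 hE0)
  refine ⟨fun K hK hlarge => ?_, fun ε hε K hK hlarge hKε => ?_, ?_⟩
  · refine (hrate K hK hlarge).trans (mul_le_mul_of_nonneg_right (by norm_num) ?_)
    exact PISCO.rate_nonneg hp0 hlam.le hL.le hσ.le (by linarith) hft0 hE0
  · exact (hrate K hK hlarge).trans (PISCO.rate_le_of_complexity_le hn hb hTo hK hp0 hlam hL hσ hα
      hft0 hE0 hε (by norm_num) hKε)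
  · rcases hft0.lt_or_eq with hft | hft
    · obtain ⟨K₀, hK₀⟩ := Filter.eventually_atTop.1
        (PISCO.eventually_rate_le hn hb hTo hp0 hlam hL hσ hα hft)
      refine ⟨K₀, fun K hK => ?_⟩
      obtain ⟨hK0, hlarge, hlead⟩ := hK₀ K hK
      have hnn : 0 ≤ PISCO.leadingRate n b To L σ ft K := by
        unfold PISCO.leadingRate; positivity
      linarith [hrate K hK0 hlarge]
    · refine ⟨0, fun K _ => ?_⟩
      rw [hgap hft.symm]
      have hnn : 0 ≤ PISCO.leadingRate n b To L σ ft K := by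
        unfold PISCO.leadingRate; positivity
      positivity
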